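/- Let $g$ be a natural number and let $\Gamma_g(2)\subset \mathrm{Sp}(g,\mathbb Z)$ be the group of integral symplectic matrices $M=\begin{pmatrix}a&b\\c&d\end{pmatrix}$ of size $2g$ with $M\equiv I_{2g} \pmod 2$. Let $\Gamma_g(4,8)$ be the set of those $M\in\mathrm{Sp}(g,\mathbb Z)$ with $M\equiv I_{2g}\pmod 4$ for which the diagonal entries of $a\,{}^tb$ and $c\,{}^td$ are divisible by $8$. Write $e(x)=e^{2\pi i x}$, let $\mathcal H_g$ be the Siegel upper half-space, and put $M\tau=(a\tau+b)(c\tau+d)^{-1}$ for $\tau\in\mathcal H_g$. For $m=\binom{m'}{m''}\in\mathbb Z^{2g}$, $\tau\in\mathcal H_g$ and $z\in\mathbb C^g$ let $$\theta_m(\tau,z)=\sum_{p\in\mathbb Z^g}\exp \pi i\Big[{}^t\big(p+\tfrac{m'}2\big)\tau\big(p+\tfrac{m'}2\big)+2\,{}^t\big(p+\tfrac{m'}2\big)\big(z+\tfrac{m''}2\big)\Big],\qquad \theta_m(\tau)=\theta_m(\tau,0).$$ Write $(s)_0$ for the vector of diagonal entries of a square matrix $s$, and put $$M\circ m=\begin{pmatrix}d&-c\\-b&a\end{pmatrix}\begin{pmatrix}m'\\m''\end{pmatrix}+\begin{pmatrix}(c\,{}^td)_0\\(a\,{}^tb)_0\end{pmatrix},$$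 $$\Phi_m(M)=-\tfrac18\big({}^tm'\,{}^tb d\,m'+{}^tm''\,{}^ta c\,m''-2\,{}^tm'\,{}^tb c\,m''-2\,{}^t(a\,{}^tb)_0(dm'-cm'')\big).$$ Let $a(M)$ be the eighth root of unity, depending on $M$ and on the choice of a continuous branch of $\det(c\tau+d)^{1/2}$ on $\mathcal H_g$, such that $\theta_{M\circ n}(M\tau)=a(M)\,e(\Phi_n(M))\det(c\tau+d)^{1/2}\theta_n(\tau)$ for all $n\in\mathbb Z^{2g}$ and $\tau\in\mathcal H_g$. For $M\in\Gamma_g(2)$ and $m\in\mathbb Z^{2g}$ the number $\chi_m(M)$ is defined by $$\theta_m(M\tau,{}^t(c\tau+d)^{-1}z)=a(M)\,\chi_m(M)\det(c\tau+d)^{1/2}\,e\big(\tfrac12\,{}^tz(c\tau+d)^{-1}c\,z\big)\,\theta_m(\tau,z)\qquad(\tau\in\mathcal H_g,\ z\in\mathbb C^g).$$ If $m$ is even, that is, if ${}^tm'm''$ is even, it is already determined by the case $z=0$, namely $\theta_m(M\tau)=a(M)\chi_m(M)\det(c\tau+d)^{1/2}\theta_m(\tau)$ for all $\tau\in\mathcal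 H_g$. Let $A_{ij}=\begin{pmatrix}\alpha&0\\0&{}^t\alpha^{-1}\end{pmatrix}$ for $1\le i,j\le g$, where $\alpha$ is $I_g$ with its $(i,j)$ entry replaced by $2$ if $i\ne j$ and by $-1$ if $i=j$. For $1\le i\le j\le g$ let $B_{ij}=\begin{pmatrix}I_g&\beta\\0&I_g\end{pmatrix}$, where $\beta$ is the zero matrix with its $(i,j)$ and $(j,i)$ entries replaced by $2$, and let $C_{ij}={}^tB_{ij}$. **Theorem.** The commutator subgroup of $\Gamma_g(2)$ is contained in $\Gamma_g(4,8)$. Fix any orders of the factors in the three products below. Every $M\in\Gamma_g(2)$ can be written as $$M=\prod_{1\le i,j\le g}A_{ij}^{p_{ij}}\prod_{1\le i\le j\le g}B_{ij}^{q_{ij}}\prod_{1\le i\le j\le g}C_{ij}^{r_{ij}}\;M'$$ with $p_{ij},q_{ij},r_{ij}\in\mathbb Z$ and $M'$ in the commutator subgroup of $\Gamma_g(2)$. Whenever $M$ is written in this way, for every $m\in\mathbb Z^{2g}$ the number $\chi_m(M)$ exists, is unique, and equals $$\chi_m(M)=(-1)^{A}\,e\big(-\tfrac B4\big),$$ where $$A=\sum_{1\le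 i,j\le g}p_{ij}m'_im''_j+\sum_{1\le i\le j\le g}q_{ij}m'_im'_j+\sum_{1\le i<j\le g}r_{ij}m''_im''_j,\qquad B=\sum_{i=1}^g q_{ii}(m'_i)^2+\sum_{i=1}^g r_{ii}(m''_i)^2.$$ -/

import Mathlib

open Matrix

noncomputable section

namespace SiegelTheta

/-- `e(x) = exp(2πix)`. -/
def e (x : ℂ) : ℂ := Complex.exp (2 * Real.pi * Complex.I * x)

/-- The Siegel modular group `Sp(g, ℤ)`. -/
abbrev Sp (g : ℕ) : Type := symplecticGroup (Fin g) ℤ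

/-- A theta characteristic `m`, with `m' = m ∘ Sum.inl` and `m'' = m ∘ Sum.inr`. -/
abbrev Characteristic (g : ℕ) : Type := Fin g ⊕ Fin g → ℤ

section Blocks

variable {g : ℕ}

/-- The blocks of `M = (a, b; c, d)`. -/
def blkA (M : Sp g) : Matrix (Fin g) (Fin g) ℤ := M.1.toBlocks₁₁

def blkB (M : Sp g) : Matrix (Fin g) (Fin g) ℤ := M.1.toBlocks₁₂

def blkC (M : Sp g) : Matrix (Fin g) (Fin g) ℤ := M.1.toBlocks₂₁

def blkD (M : Sp g) : Matrix (Fin g) (Fin g) ℤ := M.1.toBlocks₂₂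

/-- An integral matrix regarded as a complex matrix. -/
def toC (X : Matrix (Fin g) (Fin g) ℤ) : Matrix (Fin g) (Fin g) ℂ := X.map (fun x => (x : ℂ))

end Blocks

/-! ### Congruence subgroups -/

/-- `Γ_g(2)`: the matrices in `Sp(g, ℤ)` congruent to the identity modulo `2`. -/
def Gamma2 (g : ℕ) : Subgroup (Sp g) where
  carrier := {M | M.1.map (Int.castRingHom (ZMod 2)) = 1}
  one_mem' := by simp
  mul_mem' := by
    intro M N hM hN
    simp only [Set.mem_ofPred_eq] at hM hN ⊢
    rw [Submonoid.coe_mul, Matrix.map_mul, hM, hN, mul_one]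
  inv_mem' := by
    intro M hM
    simp only [Set.mem_ofPred_eq] at hM ⊢
    have h : (M.1 * (M⁻¹).1).map (Int.castRingHom (ZMod 2)) = 1 := by
      rw [← Submonoid.coe_mul, mul_inv_cancel]
      simp
    rw [Matrix.map_mul, hM, one_mul] at h
    exact h

/-- `Γ_g(4,8)`: `M ≡ 1 mod 4`, and the diagonals of `a ᵗb` and `c ᵗd` vanish modulo `8`. -/
def Gamma48 (g : ℕ) : Set (Sp g) :=
  {M | M.1.map (Int.castRingHom (ZMod 4)) = 1 ∧
    (∀ i, (8 : ℤ) ∣ (blkA M * (blkB M)ᵀ) i i) ∧ ∀ i, (8 : ℤ) ∣ (blkC M * (blkD M)ᵀ) i i}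

/-! ### Theta functions and their transformation -/

/-- The Siegel upper half-space of degree `g`. -/
def SiegelUpperHalf (g : ℕ) : Set (Matrix (Fin g) (Fin g) ℂ) :=
  {τ | τᵀ = τ ∧ (τ.map Complex.im).PosDef}

section Theta

variable {g : ℕ}

/-- The theta function `θ_m(τ, z)`. -/
def theta (m : Characteristic g) (τ : Matrix (Fin g) (Fin g) ℂ) (z : Fin g → ℂ) : ℂ :=
  ∑' p : Fin g → ℤ,
    let v : Fin g → ℂ := fun i => (p i : ℂ) + (m (Sum.inl i) : ℂ) / 2
    Complex.exp (Real.pi * Complex.I *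
      (v ⬝ᵥ (τ *ᵥ v) + 2 * (v ⬝ᵥ fun i => z i + (m (Sum.inr i) : ℂ) / 2)))

/-- The theta constant `θ_m(τ) = θ_m(τ, 0)`. -/
def thetaConst (m : Characteristic g) (τ : Matrix (Fin g) (Fin g) ℂ) : ℂ := theta m τ 0

/-- `cτ + d`. -/
def autFactor (M : Sp g) (τ : Matrix (Fin g) (Fin g) ℂ) : Matrix (Fin g) (Fin g) ℂ :=
  toC (blkC M) * τ + toC (blkD M)

/-- `Mτ = (aτ + b)(cτ + d)⁻¹`. -/
def act (M : Sp g) (τ : Matrix (Fin g) (Fin g) ℂ) : Matrix (Fin g) (Fin g) ℂ :=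
  (toC (blkA M) * τ + toC (blkB M)) * (autFactor M τ)⁻¹

/-- The operation `M ∘ m` on characteristics. -/
def charAct (M : Sp g) (m : Characteristic g) : Characteristic g :=
  Sum.elim
    (blkD M *ᵥ (m ∘ Sum.inl) - blkC M *ᵥ (m ∘ Sum.inr) + (blkC M * (blkD M)ᵀ).diag)
    (-(blkB M *ᵥ (m ∘ Sum.inl)) + blkA M *ᵥ (m ∘ Sum.inr) + (blkA M * (blkB M)ᵀ).diag)

/-- `Φ_m(M)`. -/
def Phi (m : Characteristic g) (M : Sp g) : ℂ :=
  let m₁ : Fin g → ℤ := m ∘ Sum.inl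
  let m₂ : Fin g → ℤ := m ∘ Sum.inr
  let N : ℤ := m₁ ⬝ᵥ (((blkB M)ᵀ * blkD M) *ᵥ m₁) + m₂ ⬝ᵥ (((blkA M)ᵀ * blkC M) *ᵥ m₂)
    - 2 * (m₁ ⬝ᵥ (((blkB M)ᵀ * blkC M) *ᵥ m₂))
    - 2 * ((blkA M * (blkB M)ᵀ).diag ⬝ᵥ (blkD M *ᵥ m₁ - blkC M *ᵥ m₂))
  (-1 / 8 : ℂ) * (N : ℂ)

/-- `a` is the constant `a(M)` that belongs to the branch `s` of `det(cτ + d)^{1/2}`: an eighth root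
of unity for which the transformation formula
`θ_{M∘n}(Mτ) = a(M) e(Φ_n(M)) det(cτ + d)^{1/2} θ_n(τ)` of theta constants holds for every
characteristic `n`. -/
structure IsThetaMultiplier (M : Sp g) (a : ℂ) (s : Matrix (Fin g) (Fin g) ℂ → ℂ) : Prop where
  root_of_unity : a ^ 8 = 1
  continuousOn : ContinuousOn s (SiegelUpperHalf g)
  sq_eq : ∀ τ ∈ SiegelUpperHalf g, s τ ^ 2 = (autFactor M τ).det
  transform : ∀ n : Characteristic g, ∀ τ ∈ SiegelUpperHalf g,
    thetaConst (charAct M n) (act M τ) = a * e (Phi n M) * s τ * thetaConst n τ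

/-- `χ` is a value of `χ_m(M)` as defined by theta constants:
`θ_m(Mτ) = a(M) χ_m(M) det(cτ + d)^{1/2} θ_m(τ)`. This pins `χ` down only for even `m`, since
`θ_m(τ)` vanishes identically for odd `m`. -/
def IsConstCharValue (m : Characteristic g) (M : Sp g) (χ : ℂ) : Prop :=
  ∃ (a : ℂ) (s : Matrix (Fin g) (Fin g) ℂ → ℂ), IsThetaMultiplier M a s ∧
    ∀ τ ∈ SiegelUpperHalf g, thetaConst m (act M τ) = a * χ * s τ * thetaConst m τ

/-- `χ` is a value of `χ_m(M)` as defined by theta functions: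
`θ_m(Mτ, ᵗ(cτ + d)⁻¹ z) =
  a(M) χ_m(M) det(cτ + d)^{1/2} e(½ ᵗz (cτ + d)⁻¹ c z) θ_m(τ, z)`,
with the same `a(M)`. At `z = 0` this is the relation between theta constants; it determines `χ`
for odd `m` also. -/
def IsCharValue (m : Characteristic g) (M : Sp g) (χ : ℂ) : Prop :=
  ∃ (a : ℂ) (s : Matrix (Fin g) (Fin g) ℂ → ℂ), IsThetaMultiplier M a s ∧
    ∀ τ ∈ SiegelUpperHalf g, ∀ z : Fin g → ℂ,
      theta m (act M τ) (((autFactor M τ)⁻¹)ᵀ *ᵥ z) =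
        a * χ * s τ * e (1 / 2 * (z ⬝ᵥ (((autFactor M τ)⁻¹ * toC (blkC M)) *ᵥ z))) * theta m τ z

/-- A characteristic is even if `ᵗm' m''` is even. -/
def IsEvenChar (m : Characteristic g) : Prop := Even ((m ∘ Sum.inl) ⬝ᵥ (m ∘ Sum.inr))

end Theta

/-! ### Igusa's generators -/

section Generators

variable {g : ℕ}

/-- The identity matrix with its `(i, j)` entry replaced by `2` if `i ≠ j` and by `-1` if
`i = j`. -/
def genA (i j : Fin g) : Matrix (Fin g) (Fin g) ℤ :=
  Matrix.of fun k l => if k = i ∧ l = j then (if i = j then -1 else 2) else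
    (1 : Matrix (Fin g) (Fin g) ℤ) k l

/-- The zero matrix with its `(i, j)` and `(j, i)` entries replaced by `2`. -/
def genB (i j : Fin g) : Matrix (Fin g) (Fin g) ℤ :=
  Matrix.of fun k l => if (k = i ∧ l = j) ∨ (k = j ∧ l = i) then 2 else 0

theorem isUnit_det_genA (i j : Fin g) : IsUnit (genA i j).det := by
  by_cases h : i = j
  · subst h
    have : genA i i = Matrix.diagonal (fun k => if k = i then (-1 : ℤ) else 1) := by
      ext k l
      by_cases hk : k = i <;> by_cases hl : l = i <;> by_cases hkl : k = l <;>
        simp_all [genA, Matrix.one_apply]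
    rw [this, Matrix.det_diagonal]
    simp
  · have : genA i j = Matrix.transvection i j 2 := by
      ext k l
      by_cases hk : k = i <;> by_cases hl : l = j <;>
        simp_all [genA, Matrix.transvection, Matrix.one_apply, eq_comm]
    rw [this, Matrix.det_transvection_of_ne i j h]
    exact isUnit_one

theorem genB_transpose (i j : Fin g) : (genB i j)ᵀ = genB i j := by
  ext k l
  simp only [genB, Matrix.transpose_apply, Matrix.of_apply]
  congr 1
  apply propext
  tauto

/-- `A_{ij} = (a, 0; 0, ᵗa⁻¹)`. -/
def A (i j : Fin g) : Sp g :=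
  ⟨Matrix.fromBlocks (genA i j) 0 0 (((genA i j)⁻¹)ᵀ), by
    have h := Matrix.mul_nonsing_inv _ (isUnit_det_genA i j)
    have h2 : ((genA i j)⁻¹)ᵀ * (genA i j)ᵀ = 1 := by
      rw [← Matrix.transpose_mul, h, Matrix.transpose_one]
    rw [SymplecticGroup.mem_iff, Matrix.J, Matrix.fromBlocks_multiply,
      Matrix.fromBlocks_transpose, Matrix.fromBlocks_multiply]
    simp [h, h2]⟩

/-- `B_{ij} = (1, b; 0, 1)`. -/
def B (i j : Fin g) : Sp g :=
  ⟨Matrix.fromBlocks 1 (genB i j) 0 1, by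
    rw [SymplecticGroup.mem_iff, Matrix.J, Matrix.fromBlocks_multiply,
      Matrix.fromBlocks_transpose, Matrix.fromBlocks_multiply]
    simp [genB_transpose]⟩

/-- `C_{ij} = ᵗB_{ij}`. -/
def C (i j : Fin g) : Sp g :=
  ⟨(B i j).1ᵀ, SymplecticGroup.transpose_mem (B i j).2⟩

/-- `l` lists every pair `(i, j)` with `P i j` exactly once. -/
def Enumerates (l : List (Fin g × Fin g)) (P : Fin g → Fin g → Prop) : Prop :=
  l.Nodup ∧ ∀ x : Fin g × Fin g, x ∈ l ↔ P x.1 x.2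

/-- The ordered product `∏ X_{ij}^{k_{ij}}` along the list `l`. -/
def orderedProd (l : List (Fin g × Fin g)) (X : Fin g → Fin g → Sp g)
    (k : Fin g → Fin g → ℤ) : Sp g :=
  (l.map fun x => X x.1 x.2 ^ k x.1 x.2).prod

/-- The exponent `A` of `-1`. -/
def expA (p q r : Fin g → Fin g → ℤ) (m : Characteristic g) : ℤ :=
  (∑ i, ∑ j, p i j * m (Sum.inl i) * m (Sum.inr j))
    + (∑ i, ∑ j, if i ≤ j then q i j * m (Sum.inl i) * m (Sum.inl j) else 0)
    + ∑ i, ∑ j, if i < j then r i j * m (Sum.inr i) * m (Sum.inr j) else 0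

/-- The exponent `B`. -/
def expB (q r : Fin g → Fin g → ℤ) (m : Characteristic g) : ℤ :=
  (∑ i, q i i * m (Sum.inl i) ^ 2) + ∑ i, r i i * m (Sum.inr i) ^ 2

end Generators

end SiegelTheta

end

/-!
The matrices `M` that carry `θ_0` to itself, up to an exponential factor in `z` and a continuous
factor `κ(τ)` with `κ² = ζ det(cτ + d)` and `ζ⁴ = 1`, form a group. It contains the `A_{ij}` and
`B_{ij}`, and also, by the functional equation of the Jacobi theta function in one variable, the
inversion of a single diagonal entry of `τ`, which carries `B_{ii}` to `C_{ii}` and `A_{ij}` to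
`C_{ij}`. A Euclidean algorithm on columns shows that these generate `Γ_g(2)`, so every
`M ∈ Γ_g(2)` has such a `κ`.

Translating `z` by half periods turns this into a formula that relates `θ_m` to `θ_n` with
`n = ᵗM m`. As `M ≡ 1 mod 2`, `n` differs from `m` by an even vector, so `θ_n = ±θ_m`, and `θ_m` is
multiplied by `κ` times a power of `i` whose exponent is the value at `m` of a quadratic form
attached to `M`. Modulo `4` this exponent is additive in `M`, hence it vanishes on commutators and
is determined by its values on the generators. With `m` a basis vector, its vanishing also gives the
condition modulo `8` on the diagonals of `a ᵗb` and `c ᵗd`.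
-/

noncomputable section

namespace SiegelTheta

/-! ### The symplectic form and the quadratic character of `Γ_g(2)` -/

/-- The index set of the coordinates of `ℤ^{2g}`; `Sum.swap` exchanges the two coordinates of a
hyperbolic plane. -/
abbrev Index (g : ℕ) : Type := Fin g ⊕ Fin g

variable {g : ℕ}

section SymplecticForm

/-- The standard symplectic form `ᵗu' v'' - ᵗu'' v'` on characteristics. -/
def symp : LinearMap.BilinForm ℤ (Characteristic g) := Matrix.toBilin' (-J (Fin g) ℤ)

/-- The quadratic form `ᵗu' u''` on characteristics, whose parity is the parity of `u`. -/
def quad (u : Characteristic g) : ℤ := (u ∘ Sum.inl) ⬝ᵥ (u ∘ Sum.inr)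

theorem symp_apply (u v : Characteristic g) :
    symp u v = (u ∘ Sum.inl) ⬝ᵥ (v ∘ Sum.inr) - (u ∘ Sum.inr) ⬝ᵥ (v ∘ Sum.inl) := by
  simp [symp, Matrix.toBilin'_apply', J, dotProduct, Fintype.sum_sum_type, fromBlocks_mulVec,
    neg_mulVec, sub_eq_add_neg, add_comm]

theorem symp_swap (u v : Characteristic g) : symp v u = -symp u v := by
  rw [symp_apply, symp_apply, dotProduct_comm (v ∘ Sum.inl), dotProduct_comm (v ∘ Sum.inr)]
  ring

theorem symp_single_inl (u : Characteristic g) (i : Fin g) :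
    symp u (Pi.single (Sum.inl i) 1) = -u (Sum.inr i) := by
  simp [symp_apply, dotProduct, Pi.single_apply]

theorem symp_single_inr (u : Characteristic g) (i : Fin g) :
    symp u (Pi.single (Sum.inr i) 1) = u (Sum.inl i) := by
  simp [symp_apply, dotProduct, Pi.single_apply]

theorem quad_add (u v : Characteristic g) :
    quad (u + v) = quad u + quad v + symp u v + 2 * ((u ∘ Sum.inr) ⬝ᵥ (v ∘ Sum.inl)) := by
  change (u ∘ Sum.inl + v ∘ Sum.inl) ⬝ᵥ (u ∘ Sum.inr + v ∘ Sum.inr) = _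
  rw [symp_apply, add_dotProduct, dotProduct_add, dotProduct_add,
    dotProduct_comm (v ∘ Sum.inl) (u ∘ Sum.inr), quad, quad]
  ring

theorem quad_smul (k : ℤ) (u : Characteristic g) : quad (k • u) = k ^ 2 * quad u := by
  change (k • (u ∘ Sum.inl)) ⬝ᵥ (k • (u ∘ Sum.inr)) = k ^ 2 * quad u
  rw [smul_dotProduct, dotProduct_smul, smul_smul, ← sq, smul_eq_mul, quad]

theorem two_mul_quad_add (u v : Characteristic g) :
    (2 * quad (u + v) : ZMod 4) = 2 * quad u + 2 * quad v + 2 * symp u v := by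
  have h4 : (4 : ZMod 4) = 0 := rfl
  rw [quad_add]
  push_cast
  linear_combination ((u ∘ Sum.inr) ⬝ᵥ (v ∘ Sum.inl) : ℤ) * h4

theorem symp_transpose_mulVec (M : Sp g) (u v : Characteristic g) :
    symp (M.1ᵀ *ᵥ u) (M.1ᵀ *ᵥ v) = symp u v := by
  have h : M.1 * -J (Fin g) ℤ * M.1ᵀ = -J (Fin g) ℤ := by
    rw [mul_neg, neg_mul, SymplecticGroup.mem_iff.1 M.2]
  rw [symp, toBilin'_apply', toBilin'_apply', mulVec_transpose, ← dotProduct_mulVec,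
    mulVec_mulVec, mulVec_mulVec, h]

theorem symp_mulVec (M : Sp g) (u v : Characteristic g) :
    symp (M.1 *ᵥ u) (M.1 *ᵥ v) = symp u v := by
  simpa using symp_transpose_mulVec ⟨M.1ᵀ, SymplecticGroup.transpose_mem M.2⟩ u v

end SymplecticForm

section Congruence

theorem map_intCast_eq_one_iff {ι : Type*} [DecidableEq ι] {n : ℕ} {M : Matrix ι ι ℤ} :
    M.map (Int.castRingHom (ZMod n)) = 1 ↔ ∃ X : Matrix ι ι ℤ, M = 1 + (n : ℤ) • X := by
  constructor
  · intro h
    have hdvd (i j : ι) : (n : ℤ) ∣ M i j - (1 : Matrix ι ι ℤ) i j := by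
      have hij : ((M i j : ℤ) : ZMod n) = (1 : Matrix ι ι (ZMod n)) i j := congrFun₂ h i j
      rw [← ZMod.intCast_zmod_eq_zero_iff_dvd, Int.cast_sub, hij]
      by_cases hij : i = j <;> simp [one_apply, hij]
    choose X hX using hdvd
    exact ⟨of X, by ext i j; simp [← hX i j, -zsmul_eq_mul]⟩
  · rintro ⟨X, rfl⟩
    ext i j
    by_cases hij : i = j <;> simp [one_apply, hij]

/-- The matrix `X` with `M = 1 + 2X`, for `M ∈ Γ_g(2)`. -/
def half (M : Sp g) : Matrix (Index g) (Index g) ℤ := (M.1 - 1).map (· / 2)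

theorem mem_Gamma2_iff {M : Sp g} :
    M ∈ Gamma2 g ↔ ∃ X : Matrix (Index g) (Index g) ℤ, M.1 = 1 + (2 : ℤ) • X :=
  map_intCast_eq_one_iff

theorem half_eq {M : Sp g} {X : Matrix (Index g) (Index g) ℤ} (h : M.1 = 1 + (2 : ℤ) • X) :
    half M = X := by
  ext x y
  simp [half, h, -zsmul_eq_mul]

theorem coe_eq_one_add_two_smul_half {M : Sp g} (hM : M ∈ Gamma2 g) :
    M.1 = 1 + (2 : ℤ) • half M := by
  obtain ⟨X, hX⟩ := mem_Gamma2_iff.1 hM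
  rw [half_eq hX, hX]

theorem half_one : half (1 : Sp g) = 0 := half_eq (by simp)

theorem half_mul {M N : Sp g} (hM : M ∈ Gamma2 g) (hN : N ∈ Gamma2 g) :
    half (M * N) = half M + half N + (2 : ℤ) • (half M * half N) := by
  refine half_eq ?_
  rw [Submonoid.coe_mul, coe_eq_one_add_two_smul_half hM, coe_eq_one_add_two_smul_half hN]
  simp only [mul_add, add_mul, mul_one, one_mul, smul_mul_smul_comm, smul_add, smul_smul]
  abel

theorem odd_apply_self {M : Sp g} (hM : M ∈ Gamma2 g) (x : Index g) : Odd (M.1 x x) :=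
  ⟨half M x x, by
    simpa [add_comm, -zsmul_eq_mul] using congrFun₂ (coe_eq_one_add_two_smul_half hM) x x⟩

theorem even_apply_of_ne {M : Sp g} (hM : M ∈ Gamma2 g) {x y : Index g} (h : x ≠ y) :
    Even (M.1 x y) :=
  even_iff_exists_two_mul.2 ⟨half M x y, by
    simpa [one_apply_ne h, -zsmul_eq_mul] using congrFun₂ (coe_eq_one_add_two_smul_half hM) x y⟩

/-- Half of `ᵗM m - m`, for `M ∈ Γ_g(2)`. -/
def halfDiff (M : Sp g) (m : Characteristic g) : Characteristic g := (half M)ᵀ *ᵥ m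

theorem transpose_mulVec_eq {M : Sp g} (hM : M ∈ Gamma2 g) (m : Characteristic g) :
    M.1ᵀ *ᵥ m = m + (2 : ℤ) • halfDiff M m := by
  conv_lhs => rw [coe_eq_one_add_two_smul_half hM]
  simp only [transpose_add, transpose_one, transpose_smul, add_mulVec, one_mulVec, smul_mulVec,
    halfDiff]

theorem halfDiff_mul {M N : Sp g} (hM : M ∈ Gamma2 g) (hN : N ∈ Gamma2 g)
    (m : Characteristic g) :
    halfDiff (M * N) m
      = halfDiff M m + (halfDiff N m + (2 : ℤ) • halfDiff N (halfDiff M m)) := by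
  simp only [halfDiff, half_mul hM hN, transpose_add, transpose_smul, transpose_mul, add_mulVec,
    smul_mulVec, mulVec_mulVec, add_assoc]

end Congruence

section QuadraticCharacter

/-- The exponent, modulo `4`, of `i` in `χ_m(M)`. -/
def chiExp (m : Characteristic g) (M : Sp g) : ℤ :=
  symp m (halfDiff M m) - 2 * quad (halfDiff M m)

theorem two_mul_chiExp {M : Sp g} (hM : M ∈ Gamma2 g) (m : Characteristic g) :
    2 * chiExp m M = quad m - quad (M.1ᵀ *ᵥ m)
      + 4 * ((m ∘ Sum.inl) ⬝ᵥ (halfDiff M m ∘ Sum.inr)) := by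
  have h : ((2 : ℤ) • halfDiff M m) ∘ (Sum.inl : Fin g → Index g)
    = (2 : ℤ) • (halfDiff M m ∘ Sum.inl) := rfl
  rw [transpose_mulVec_eq hM, quad_add, quad_smul, map_smul, smul_eq_mul, chiExp, h,
    dotProduct_smul, smul_eq_mul, symp_apply]
  ring

theorem chiExp_mul (m : Characteristic g) {M N : Sp g} (hM : M ∈ Gamma2 g) (hN : N ∈ Gamma2 g) :
    (chiExp m (M * N) : ZMod 4) = chiExp m M + chiExp m N := by
  have h4 : (4 : ZMod 4) = 0 := rfl
  have hskew := symp_swap (halfDiff M m) (halfDiff N m)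
  have hk := halfDiff_mul hM hN m
  have hinv := symp_transpose_mulVec N m (halfDiff M m)
  rw [transpose_mulVec_eq hN, transpose_mulVec_eq hN] at hinv
  unfold chiExp
  generalize halfDiff (M * N) m = k, halfDiff N (halfDiff M m) = w at *
  have hcross : symp m w = symp (halfDiff M m) (halfDiff N m) - 2 * symp (halfDiff N m) w := by
    simp only [map_add, map_smul, LinearMap.add_apply, LinearMap.smul_apply, smul_eq_mul] at hinv
    linarith
  have hquad : (2 * quad k : ZMod 4) = 2 * quad (halfDiff M m) + 2 * quad (halfDiff N m)
      + 2 * symp (halfDiff M m) (halfDiff N m) := by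
    rw [hk, two_mul_quad_add, two_mul_quad_add, quad_smul]
    simp only [map_add, map_smul, smul_eq_mul]
    push_cast
    linear_combination (2 * quad w + symp (halfDiff N m) w + symp (halfDiff M m) w) * h4
  have hsymp : symp m k = symp m (halfDiff M m) + symp m (halfDiff N m) + 2 * symp m w := by
    simp only [hk, map_add, map_smul, smul_eq_mul, add_assoc]
  rw [hsymp, hcross]
  push_cast
  linear_combination -hquad - symp (halfDiff N m) w * h4

theorem chiExp_one (m : Characteristic g) : chiExp m 1 = 0 := by
  simp [chiExp, halfDiff, half_one, quad]

/-- The character `M ↦ chiExp m M mod 4` of `Γ_g(2)`. -/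
def chiHom (m : Characteristic g) : Gamma2 g →* Multiplicative (ZMod 4) where
  toFun M := Multiplicative.ofAdd (chiExp m M.1 : ZMod 4)
  map_one' := by simp [chiExp_one]
  map_mul' M N := congrArg Multiplicative.ofAdd (chiExp_mul m M.2 N.2)

/-- The homomorphism `1 + 2X ↦ X mod 2` on `Γ_g(2)`. -/
def halfHom (g : ℕ) : Gamma2 g →* Multiplicative (Matrix (Index g) (Index g) (ZMod 2)) where
  toFun M := Multiplicative.ofAdd ((half M.1).map (Int.castRingHom (ZMod 2)))
  map_one' := by simp [half_one]
  map_mul' M N := by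
    have h2 : (2 : ZMod 2) = 0 := rfl
    rw [← ofAdd_add]
    congr 1
    ext x y
    simp [half_mul M.2 N.2, h2, -zsmul_eq_mul]

end QuadraticCharacter

section Commutator

theorem commutator_le_self {G : Type*} [Group G] (H : Subgroup G) : ⁅H, H⁆ ≤ H :=
  Subgroup.commutator_le.2 fun _ hx _ hy => by
    simpa [commutatorElement_def] using
      H.mul_mem (H.mul_mem (H.mul_mem hx hy) (H.inv_mem hx)) (H.inv_mem hy)

theorem map_eq_one_of_mem_commutator {G α : Type*} [Group G] [CommGroup α] {H : Subgroup G}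
    (f : H →* α) {x : G} (hx : x ∈ H) (h : x ∈ ⁅H, H⁆) : f ⟨x, hx⟩ = 1 := by
  rw [← Subgroup.map_subtype_commutator] at h
  obtain ⟨y, hy, rfl⟩ := h
  exact Abelianization.commutator_subset_ker f hy

theorem eight_dvd_mul_transpose_diag {P Q : Matrix (Fin g) (Fin g) ℤ} {i : Fin g}
    (h : 2 ∣ Q i i) : 8 ∣ ((1 + (4 : ℤ) • P) * ((4 : ℤ) • Q)ᵀ) i i := by
  obtain ⟨w, hw⟩ := h
  refine ⟨w + 2 * (P * Qᵀ) i i, ?_⟩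
  simp [add_mul, hw, -zsmul_eq_mul]
  ring

theorem commutator_subset_Gamma48 {M : Sp g} (h : M ∈ ⁅Gamma2 g, Gamma2 g⁆) : M ∈ Gamma48 g := by
  have hM : M ∈ Gamma2 g := commutator_le_self _ h
  obtain ⟨Z, hZ⟩ : ∃ Z : Matrix (Index g) (Index g) ℤ, half M = (2 : ℤ) • Z := by
    have hhalf : (half M).map (Int.castRingHom (ZMod 2)) = 0 :=
      map_eq_one_of_mem_commutator (halfHom g) hM h
    have hdvd (x y : Index g) : (2 : ℤ) ∣ half M x y :=
      (ZMod.intCast_zmod_eq_zero_iff_dvd _ 2).1 (congrFun₂ hhalf x y)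
    choose Z hZ using hdvd
    exact ⟨of Z, by ext x y; simp [hZ x y, -zsmul_eq_mul]⟩
  have hMZ : M.1 = 1 + (4 : ℤ) • Z := by
    rw [coe_eq_one_add_two_smul_half hM, hZ, smul_smul]
    rfl
  have hsymp (m : Characteristic g) : (2 : ℤ) ∣ symp m (Zᵀ *ᵥ m) := by
    have hchi : (4 : ℤ) ∣ chiExp m M := (ZMod.intCast_zmod_eq_zero_iff_dvd _ 4).1
      (map_eq_one_of_mem_commutator (chiHom m) hM h)
    rw [chiExp, halfDiff, hZ, transpose_smul, smul_mulVec, quad_smul, map_smul, smul_eq_mul] at hchi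
    lia
  refine ⟨map_intCast_eq_one_iff.2 ⟨Z, hMZ⟩, fun i => ?_, fun i => ?_⟩
  · have ha : blkA M = 1 + (4 : ℤ) • Z.toBlocks₁₁ := by
      ext; simp [blkA, hMZ, toBlocks₁₁, one_apply, -zsmul_eq_mul]
    have hb : blkB M = (4 : ℤ) • Z.toBlocks₁₂ := by
      ext; simp [blkB, hMZ, toBlocks₁₂, -zsmul_eq_mul]
    rw [ha, hb]
    refine eight_dvd_mul_transpose_diag ?_
    simpa [symp_apply, dotProduct, Pi.single_apply, toBlocks₁₂] using
      hsymp (Pi.single (Sum.inl i) 1)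
  · have hc : blkC M = (4 : ℤ) • Z.toBlocks₂₁ := by
      ext; simp [blkC, hMZ, toBlocks₂₁, -zsmul_eq_mul]
    have hd : blkD M = 1 + (4 : ℤ) • Z.toBlocks₂₂ := by
      ext; simp [blkD, hMZ, toBlocks₂₂, one_apply, -zsmul_eq_mul]
    rw [← transpose_apply (_ * _) i i, transpose_mul, transpose_transpose, hc, hd]
    refine eight_dvd_mul_transpose_diag ?_
    simpa [symp_apply, dotProduct, Pi.single_apply, toBlocks₂₁] using
      hsymp (Pi.single (Sum.inr i) 1)

end Commutator

/-! ### Igusa's generators generate `Γ_g(2)` -/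

section Generators

theorem map_zpow_eq_one_add_zsmul {G R : Type*} [Group G] [Ring R] (f : G →* R) {x : G} {N : R}
    (h : f x = 1 + N) (hN : N * N = 0) (k : ℤ) : f (x ^ k) = 1 + k • N := by
  have hinv : f x⁻¹ = 1 - N := by
    calc f x⁻¹ = f x⁻¹ * ((1 + N) * (1 - N)) := by simp [mul_sub, add_mul, hN]
      _ = 1 - N := by rw [← h, ← mul_assoc, ← map_mul, inv_mul_cancel, map_one, one_mul]
  induction k with
  | zero => simp
  | succ k ih =>
    rw [_root_.zpow_add_one, map_mul, ih, h, add_mul, mul_add, smul_mul_assoc, mul_add, hN,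
      add_smul, one_smul, mul_one, one_mul, mul_one, add_zero]
    abel
  | pred k ih =>
    rw [_root_.zpow_sub_one, map_mul, ih, hinv, add_mul, mul_sub, smul_mul_assoc, mul_sub, hN,
      sub_smul, one_smul, mul_one, one_mul, mul_one, sub_zero]
    abel

theorem genA_of_ne {i j : Fin g} (h : i ≠ j) : genA i j = 1 + single i j 2 := by
  ext k l
  by_cases hk : k = i <;> by_cases hl : l = j <;> simp_all [genA, one_apply, eq_comm]

theorem inv_genA_of_ne {i j : Fin g} (h : i ≠ j) : (genA i j)⁻¹ = 1 - single i j 2 := by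
  apply inv_eq_right_inv
  rw [genA_of_ne h]
  simp [mul_sub, add_mul, h.symm]

theorem genA_self (i : Fin g) : genA i i = diagonal (Function.update 1 i (-1)) := by
  ext k l
  by_cases hk : k = i <;> by_cases hl : l = i <;> by_cases hkl : k = l <;>
    simp_all [genA, one_apply]

theorem inv_genA_self (i : Fin g) : (genA i i)⁻¹ = genA i i := by
  apply inv_eq_right_inv
  rw [genA_self, diagonal_mul_diagonal, ← diagonal_one]
  congr 1
  ext k
  by_cases hk : k = i <;> simp [hk]

theorem genB_self (i : Fin g) : genB i i = single i i 2 := by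
  ext k l
  by_cases hk : k = i <;> by_cases hl : l = i <;> simp_all [genB, single_apply, eq_comm]

theorem genB_of_ne {i j : Fin g} (h : i ≠ j) : genB i j = single i j 2 + single j i 2 := by
  ext k l
  by_cases hk : k = i <;> by_cases hl : l = j <;> by_cases hk' : k = j <;> by_cases hl' : l = i <;>
    simp_all [genB, single_apply, eq_comm]

theorem coe_A_self (i : Fin g) :
    (A i i).1 = diagonal (Sum.elim (Function.update 1 i (-1)) (Function.update 1 i (-1))) := by
  change fromBlocks (genA i i) 0 0 ((genA i i)⁻¹)ᵀ = _
  rw [inv_genA_self, genA_self, diagonal_transpose, fromBlocks_diagonal]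

/-- The elementary matrix with a `2` in position `(x, y)`; up to inversion these are the
generators `A_{ij}` (`i ≠ j`), `B_{ij}` and `C_{ij}`, treated uniformly. -/
def elem : Index g → Index g → Sp g
  | Sum.inl i, Sum.inl j => A i j
  | Sum.inl i, Sum.inr j => B i j
  | Sum.inr i, Sum.inl j => C i j
  | Sum.inr i, Sum.inr j => (A j i)⁻¹

/-- The coefficient of `elem x y` in its position `(y.swap, x.swap)`, halved: a sign, or `0` where
that position coincides with `(x, y)`. -/
def dualCoeff (x y : Index g) : ℤ :=
  if x = y.swap then 0 else if x.isLeft = y.isLeft then -1 else 1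

/-- The matrix `N` with `elem x y = 1 + 2N`. -/
def elemStep (x y : Index g) : Matrix (Index g) (Index g) ℤ :=
  single x y 1 + single y.swap x.swap (dualCoeff x y)

theorem ne_swap (x : Index g) : x ≠ x.swap := by
  rcases x with i | i <;> simp

theorem elemStep_mul_self {x y : Index g} (h : x ≠ y) : elemStep x y * elemStep x y = 0 := by
  by_cases hxy : x = y.swap
  · simp [elemStep, dualCoeff, hxy, single_mul_single_of_ne _ _ _ _ (hxy ▸ h).symm]
  · have hinj : x.swap ≠ y.swap := Sum.swap_leftInverse.injective.ne h
    simp [elemStep, mul_add, add_mul, h.symm, (ne_swap x).symm, hinj,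
      single_mul_single_of_ne _ _ _ _ (ne_swap y)]

theorem smul_elemStep_mul_self {x y : Index g} (h : x ≠ y) (k : ℤ) :
    (k • elemStep x y) * (k • elemStep x y) = 0 := by
  rw [smul_mul_smul_comm, elemStep_mul_self h, smul_zero]

theorem coe_A_of_ne {i j : Fin g} (h : i ≠ j) :
    (A i j).1 = 1 + (2 : ℤ) • elemStep (Sum.inl i) (Sum.inl j) := by
  change fromBlocks (genA i j) 0 0 ((genA i j)⁻¹)ᵀ = _
  rw [inv_genA_of_ne h, genA_of_ne h]
  ext (x | x) (y | y) <;>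
    simp [elemStep, dualCoeff, single_apply, one_apply, eq_comm, and_comm, sub_eq_add_neg,
      apply_ite (Neg.neg : ℤ → ℤ)]

theorem coe_B (i j : Fin g) : (B i j).1 = 1 + (2 : ℤ) • elemStep (Sum.inl i) (Sum.inr j) := by
  by_cases h : i = j
  · subst h
    simp only [B, genB_self]
    ext (x | x) (y | y) <;> simp [elemStep, dualCoeff, single_apply, one_apply]
  · simp only [B, genB_of_ne h]
    ext (x | x) (y | y) <;> simp [elemStep, dualCoeff, h, single_apply, one_apply]

theorem coe_C (i j : Fin g) : (C i j).1 = 1 + (2 : ℤ) • elemStep (Sum.inr i) (Sum.inl j) := by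
  have hstep : (elemStep (Sum.inl i) (Sum.inr j))ᵀ = elemStep (Sum.inr i) (Sum.inl j) := by
    by_cases h : i = j
    · simp [elemStep, dualCoeff, h]
    · simp [elemStep, dualCoeff, h, add_comm]
  simp only [C, coe_B, transpose_add, transpose_one, transpose_smul, hstep]

theorem coe_elem {x y : Index g} (h : x ≠ y) : (elem x y).1 = 1 + (2 : ℤ) • elemStep x y := by
  rcases x with i | i <;> rcases y with j | j
  · exact coe_A_of_ne (by simpa using h)
  · exact coe_B i j
  · exact coe_C i j
  · have hji : Sum.inl j ≠ (Sum.inl i : Index g) := by simpa [eq_comm] using h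
    have hinv := map_zpow_eq_one_add_zsmul (symplecticGroup (Fin g) ℤ).subtype
      (x := A j i) (coe_A_of_ne (by simpa using hji)) (smul_elemStep_mul_self hji 2) (-1)
    rw [_root_.zpow_neg_one] at hinv
    refine hinv.trans ?_
    ext u v
    simp [elemStep, dualCoeff, single_apply, apply_ite (Neg.neg : ℤ → ℤ), add_comm]

theorem coe_elem_zpow {x y : Index g} (h : x ≠ y) (k : ℤ) :
    (elem x y ^ k).1 = 1 + (2 * k) • elemStep x y := by
  have hpow := map_zpow_eq_one_add_zsmul (symplecticGroup (Fin g) ℤ).subtype (coe_elem h)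
    (smul_elemStep_mul_self h 2) k
  rwa [smul_smul, mul_comm] at hpow

theorem single_mul_apply_eq_ite {ι R : Type*} [Fintype ι] [DecidableEq ι]
    [NonUnitalNonAssocSemiring R] (i j : ι) (c : R) (M : Matrix ι ι R) (k l : ι) :
    (single i j c * M) k l = if k = i then c * M j l else 0 := by
  by_cases h : k = i
  · subst h; simp
  · simp [h]

theorem elem_zpow_mul_apply {x y : Index g} (h : x ≠ y) (k : ℤ) (M : Sp g) (u v : Index g) :
    (elem x y ^ k * M).1 u v = M.1 u v + 2 * k * ((if u = x then M.1 y v else 0)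
      + if u = y.swap then dualCoeff x y * M.1 x.swap v else 0) := by
  simp only [Submonoid.coe_mul, coe_elem_zpow h, elemStep, add_mul, one_mul, smul_mul_assoc,
    Matrix.add_apply, Matrix.smul_apply, single_mul_apply_eq_ite, smul_eq_mul]

theorem elem_zpow_mul_apply_left {x y : Index g} (h : x ≠ y) (k : ℤ) (M : Sp g) (v : Index g) :
    (elem x y ^ k * M).1 x v = M.1 x v + 2 * k * M.1 y v := by
  rw [elem_zpow_mul_apply h, if_pos rfl]
  by_cases hxy : x = y.swap
  · simp [dualCoeff, hxy]
  · rw [if_neg hxy, add_zero]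

theorem elem_zpow_mul_apply_of_ne {x y u : Index g} (h : x ≠ y) (hx : u ≠ x) (hy : u ≠ y.swap)
    (k : ℤ) (M : Sp g) (v : Index g) : (elem x y ^ k * M).1 u v = M.1 u v := by
  rw [elem_zpow_mul_apply h, if_neg hx, if_neg hy, add_zero, mul_zero, add_zero]

theorem elem_mem_Gamma2 {x y : Index g} (h : x ≠ y) : elem x y ∈ Gamma2 g :=
  mem_Gamma2_iff.2 ⟨_, coe_elem h⟩

theorem A_mem_Gamma2 (i j : Fin g) : A i j ∈ Gamma2 g := by
  by_cases h : i = j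
  · subst h
    refine mem_Gamma2_iff.2 ⟨diagonal (Sum.elim (Pi.single i (-1)) (Pi.single i (-1))), ?_⟩
    rw [coe_A_self, ← diagonal_one, ← diagonal_smul, diagonal_add]
    congr 1
    ext (k | k) <;> by_cases hk : k = i <;> simp [hk]
  · exact elem_mem_Gamma2 (x := Sum.inl i) (y := Sum.inl j) (by simpa using h)

theorem B_mem_Gamma2 (i j : Fin g) : B i j ∈ Gamma2 g :=
  mem_Gamma2_iff.2 ⟨_, coe_B i j⟩

theorem C_mem_Gamma2 (i j : Fin g) : C i j ∈ Gamma2 g :=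
  mem_Gamma2_iff.2 ⟨_, coe_C i j⟩

/-- The subgroup generated by the `A_{ij}`, `B_{ij}` and `C_{ij}`. -/
def genGroup (g : ℕ) : Subgroup (Sp g) :=
  Subgroup.closure (Set.range (fun x : Fin g × Fin g => A x.1 x.2)
    ∪ Set.range (fun x : Fin g × Fin g => B x.1 x.2)
    ∪ Set.range (fun x : Fin g × Fin g => C x.1 x.2))

theorem genGroup_le {H : Subgroup (Sp g)} (hA : ∀ i j, A i j ∈ H) (hB : ∀ i j, B i j ∈ H)
    (hC : ∀ i j, C i j ∈ H) : genGroup g ≤ H := by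
  rw [genGroup, Subgroup.closure_le]
  rintro _ ((⟨x, rfl⟩ | ⟨x, rfl⟩) | ⟨x, rfl⟩)
  exacts [hA x.1 x.2, hB x.1 x.2, hC x.1 x.2]

theorem genGroup_le_Gamma2 : genGroup g ≤ Gamma2 g :=
  genGroup_le A_mem_Gamma2 B_mem_Gamma2 C_mem_Gamma2

theorem A_mem_genGroup (i j : Fin g) : A i j ∈ genGroup g :=
  Subgroup.subset_closure (Or.inl (Or.inl ⟨(i, j), rfl⟩))

theorem elem_mem_genGroup (x y : Index g) : elem x y ∈ genGroup g := by
  rcases x with i | i <;> rcases y with j | j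
  · exact A_mem_genGroup i j
  · exact Subgroup.subset_closure (Or.inl (Or.inr ⟨(i, j), rfl⟩))
  · exact Subgroup.subset_closure (Or.inr ⟨(i, j), rfl⟩)
  · exact inv_mem (A_mem_genGroup j i)

end Generators

section Elimination

/-- The matrices in `Sp(g, ℤ)` that fix the basis vectors with index in `T`. -/
def basisFixer (T : Set (Index g)) : Subgroup (Sp g) where
  carrier := {M | ∀ y ∈ T, M.1 *ᵥ Pi.single y 1 = Pi.single y 1}
  one_mem' _ _ := one_mulVec _
  mul_mem' {M N} hM hN y hy := by
    rw [Submonoid.coe_mul, ← mulVec_mulVec, hN y hy, hM y hy]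
  inv_mem' {M} hM y hy := by
    conv_lhs => rw [← hM y hy, mulVec_mulVec, ← Submonoid.coe_mul, inv_mul_cancel]
    exact one_mulVec _

theorem mem_basisFixer_iff {T : Set (Index g)} {M : Sp g} :
    M ∈ basisFixer T ↔ ∀ y ∈ T, ∀ x, M.1 x y = (1 : Matrix (Index g) (Index g) ℤ) x y := by
  refine forall₂_congr fun y _ => ?_
  rw [mulVec_single_one, funext_iff]
  simp only [col_apply, one_apply, Pi.single_apply]

theorem apply_eq_one_apply_of_swap_mem {T : Set (Index g)} {M : Sp g} (hM : M ∈ basisFixer T)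
    {x : Index g} (hx : x.swap ∈ T) (y : Index g) :
    M.1 x y = (1 : Matrix (Index g) (Index g) ℤ) x y := by
  have h := symp_mulVec M (Pi.single y 1) (Pi.single x.swap 1)
  rw [hM _ hx] at h
  rcases x with i | i <;>
    simpa [symp_single_inl, symp_single_inr, Pi.single_apply, one_apply] using h

theorem elem_mem_basisFixer {T : Set (Index g)} {x y : Index g} (h : x ≠ y) (hy : y ∉ T)
    (hx : x.swap ∉ T) : elem x y ∈ basisFixer T := by
  refine mem_basisFixer_iff.2 fun v hv u => ?_
  have hyv : y ≠ v := fun h' => hy (h' ▸ hv)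
  have hxv : x.swap ≠ v := fun h' => hx (h' ▸ hv)
  simp [coe_elem h, elemStep, hyv, hxv]

theorem A_self_mem_basisFixer {T : Set (Index g)} {i : Fin g} (hl : Sum.inl i ∉ T)
    (hr : Sum.inr i ∉ T) : A i i ∈ basisFixer T := by
  refine mem_basisFixer_iff.2 fun v hv u => ?_
  have hv' (s : Index g) (hs : s ∉ T) : v ≠ s := fun h' => hs (h' ▸ hv)
  rw [coe_A_self, diagonal_apply, one_apply]
  split_ifs with huv
  · subst huv
    rcases u with k | k <;> simp_all
  · rfl

theorem exists_abs_add_two_mul_le (a : ℤ) {b : ℤ} (hb : b ≠ 0) :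
    ∃ k : ℤ, |a + 2 * k * b| ≤ |b| := by
  have hpos : 0 < 2 * b.natAbs := by lia
  refine ⟨-(a.bdiv (2 * b.natAbs) * b.sign), ?_⟩
  have hbmod : a + 2 * -(a.bdiv (2 * b.natAbs) * b.sign) * b = a.bmod (2 * b.natAbs) := by
    rw [Int.bmod_eq_self_sub_bdiv_mul, Nat.cast_mul, Int.natCast_natAbs, ← Int.sign_mul_self_eq_abs]
    push_cast
    ring
  have hle := Int.bmod_le (x := a) hpos
  have hge := Int.le_bmod (x := a) hpos
  rw [hbmod, abs_le, Int.abs_eq_natAbs]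
  lia

theorem isUnit_of_dvd_col {M : Sp g} {y : Index g} {d : ℤ} (h : ∀ x, d ∣ M.1 x y) :
    IsUnit d := by
  have hinv : (M⁻¹).1 * M.1 = 1 := by rw [← Submonoid.coe_mul, inv_mul_cancel]; rfl
  have hyy := congrFun₂ hinv y y
  rw [mul_apply, one_apply_eq] at hyy
  exact isUnit_of_dvd_one (hyy ▸ Finset.dvd_sum fun z _ => (h z).mul_left _)

theorem genGroup_inf_basisFixer_le (T : Set (Index g)) :
    genGroup g ⊓ basisFixer T ≤ Gamma2 g ⊓ basisFixer T :=
  inf_le_inf_right _ genGroup_le_Gamma2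

/-- Euclidean division by twice the pivot makes an entry of its column smaller than the pivot, and
Euclidean division by twice that entry then makes the pivot smaller; equality is excluded by
parity. -/
theorem exists_smaller_pivot {T : Set (Index g)} (hT : ∀ x ∈ T, x.swap ∈ T) {M : Sp g}
    (hM : M ∈ Gamma2 g ⊓ basisFixer T) {x y : Index g} (hy : y ∉ T)
    (hdvd : ¬ M.1 y y ∣ M.1 x y) :
    ∃ E ∈ genGroup g ⊓ basisFixer T, |(E * M).1 y y| < |M.1 y y| := by
  have hxy : x ≠ y := by rintro rfl; exact hdvd dvd_rfl
  have hswap {z : Index g} (hz : z ∉ T) : z.swap ∉ T := fun h => hz (by simpa using hT _ h)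
  have hx : x ∉ T := fun h => hdvd <| by
    rw [apply_eq_one_apply_of_swap_mem hM.2 (hT x h), one_apply_ne hxy]
    exact dvd_zero _
  have hodd := odd_apply_self hM.1 y
  obtain ⟨k, hk⟩ := exists_abs_add_two_mul_le (M.1 x y) (b := M.1 y y)
    (by rintro h; simp [h] at hodd)
  have hxk := elem_zpow_mul_apply_left hxy k M y
  have hlt : |(elem x y ^ k * M).1 x y| < |M.1 y y| := by
    refine lt_of_le_of_ne (hxk ▸ hk) fun h => ?_
    obtain ⟨v, hv⟩ := even_apply_of_ne hM.1 hxy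
    obtain ⟨u, hu⟩ := hodd
    rw [hxk, abs_eq_abs, hv, mul_assoc] at h
    lia
  obtain ⟨l, hl⟩ := exists_abs_add_two_mul_le ((elem x y ^ k * M).1 y y)
    (b := (elem x y ^ k * M).1 x y) (fun h => hdvd ⟨-(2 * k), by linear_combination h - hxk⟩)
  refine ⟨elem y x ^ l * elem x y ^ k, mul_mem (zpow_mem ?_ l) (zpow_mem ?_ k), ?_⟩
  · exact Subgroup.mem_inf.2 ⟨elem_mem_genGroup y x, elem_mem_basisFixer hxy.symm hx (hswap hy)⟩
  · exact Subgroup.mem_inf.2 ⟨elem_mem_genGroup x y, elem_mem_basisFixer hxy hy (hswap hx)⟩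
  · rw [mul_assoc, elem_zpow_mul_apply_left hxy.symm]
    exact hl.trans_lt hlt

theorem exists_pivot_eq_one {T : Set (Index g)} (hT : ∀ x ∈ T, x.swap ∈ T) {j : Fin g}
    (hj : Sum.inl j ∉ T) {M : Sp g} (hM : M ∈ Gamma2 g ⊓ basisFixer T) :
    ∃ E ∈ genGroup g ⊓ basisFixer T, (E * M).1 (Sum.inl j) (Sum.inl j) = 1 := by
  induction hn : (M.1 (Sum.inl j) (Sum.inl j)).natAbs using Nat.strong_induction_on
    generalizing M with
  | _ n ih =>
    by_cases hdvd : ∀ x, M.1 (Sum.inl j) (Sum.inl j) ∣ M.1 x (Sum.inl j)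
    · rcases Int.isUnit_iff.1 (isUnit_of_dvd_col hdvd) with h | h
      · exact ⟨1, one_mem _, by rwa [one_mul]⟩
      · refine ⟨A j j, ⟨A_mem_genGroup j j, A_self_mem_basisFixer hj fun h => hj (hT _ h)⟩, ?_⟩
        simp [coe_A_self, h]
    · obtain ⟨x, hx⟩ := not_forall.1 hdvd
      obtain ⟨E, hE, hlt⟩ := exists_smaller_pivot hT hM hj hx
      obtain ⟨F, hF, hone⟩ := ih _ (by rw [← hn]; zify; exact hlt)
        (mul_mem (genGroup_inf_basisFixer_le T hE) hM) rfl
      exact ⟨F * E, mul_mem hF hE, by rwa [mul_assoc]⟩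

theorem exists_clear_entry {T : Set (Index g)} {M : Sp g} (hM : M ∈ basisFixer T) {x y : Index g}
    (hy : y ∉ T) (hxy : x ≠ y) (hpivot : M.1 y y = 1) (heven : Even (M.1 x y)) :
    ∃ E ∈ genGroup g ⊓ basisFixer T, (E * M).1 x y = 0 ∧
      ∀ z ≠ x, z ≠ y.swap → (E * M).1 z y = M.1 z y := by
  by_cases hx : x.swap ∈ T
  · refine ⟨1, one_mem _, ?_, fun _ _ _ => by rw [one_mul]⟩
    rw [one_mul, apply_eq_one_apply_of_swap_mem hM hx, one_apply_ne hxy]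
  · obtain ⟨w, hw⟩ := heven
    refine ⟨elem x y ^ (-w), zpow_mem (Subgroup.mem_inf.2
      ⟨elem_mem_genGroup x y, elem_mem_basisFixer hxy hy hx⟩) _, ?_,
      fun z hzx hzy => elem_zpow_mul_apply_of_ne hxy hzx hzy _ _ _⟩
    rw [elem_zpow_mul_apply_left hxy, hpivot, hw]
    ring

/-- Clearing the entry in row `x` also changes row `y.swap`, so the entry in that row comes
last. -/
theorem exists_clear_col {T : Set (Index g)} {M : Sp g} (hM : M ∈ Gamma2 g ⊓ basisFixer T)
    {y : Index g} (hy : y ∉ T) (hpivot : M.1 y y = 1) :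
    ∃ E ∈ genGroup g ⊓ basisFixer T, E * M ∈ basisFixer (insert y T) := by
  have hclear (S : Finset (Index g)) (hS : y ∉ S) (hS' : y.swap ∉ S) :
      ∃ E ∈ genGroup g ⊓ basisFixer T, (E * M).1 y y = 1 ∧ ∀ x ∈ S, (E * M).1 x y = 0 := by
    induction S using Finset.induction_on with
    | empty => exact ⟨1, one_mem _, by rwa [one_mul], by simp⟩
    | insert x S hxS ih =>
      rw [Finset.mem_insert, not_or] at hS hS'
      obtain ⟨E, hE, hone, hzero⟩ := ih hS.2 hS'.2
      have hEM := mul_mem (genGroup_inf_basisFixer_le T hE) hM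
      obtain ⟨F, hF, hx, hF'⟩ := exists_clear_entry hEM.2 hy (Ne.symm hS.1) hone
        (even_apply_of_ne hEM.1 (Ne.symm hS.1))
      refine ⟨F * E, mul_mem hF hE, ?_, ?_⟩
      · rw [mul_assoc, hF' y hS.1 (ne_swap y), hone]
      · rw [mul_assoc, Finset.forall_mem_insert]
        refine ⟨hx, fun z hz => ?_⟩
        rw [hF' z (by rintro rfl; exact hxS hz) (by rintro rfl; exact hS'.2 hz), hzero z hz]
  obtain ⟨E, hE, hone, hzero⟩ := hclear (Finset.univ \ {y, y.swap}) (by simp) (by simp)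
  have hEM := mul_mem (genGroup_inf_basisFixer_le T hE) hM
  obtain ⟨F, hF, hy', hF'⟩ := exists_clear_entry hEM.2 hy (ne_swap y).symm hone
    (even_apply_of_ne hEM.1 (ne_swap y).symm)
  refine ⟨F * E, mul_mem hF hE, mem_basisFixer_iff.2 ?_⟩
  rw [mul_assoc, Set.forall_mem_insert]
  refine ⟨fun x => ?_, mem_basisFixer_iff.1 (mul_mem hF.2 hEM.2)⟩
  by_cases hxy' : x = y.swap
  · rw [hxy', hy', one_apply_ne (ne_swap y).symm]
  · rw [hF' x hxy' hxy']
    by_cases hxy : x = y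
    · rw [hxy, hone, one_apply_eq]
    · rw [hzero x (by simp [hxy, hxy']), one_apply_ne hxy]

theorem mem_genGroup_of_mem_basisFixer (S : Finset (Fin g)) {M : Sp g}
    (hM : M ∈ Gamma2 g ⊓ basisFixer {x | Sum.elim id id x ∉ S}) : M ∈ genGroup g := by
  induction S using Finset.induction_on generalizing M with
  | empty =>
    have hone : M = 1 := Subtype.ext <| by
      ext x y
      exact mem_basisFixer_iff.1 hM.2 y (by simp) x
    exact hone ▸ one_mem _
  | insert j S hj ih =>
    set T : Set (Index g) := {x | Sum.elim id id x ∉ insert j S} with hT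
    obtain ⟨E, hE, hone⟩ := exists_pivot_eq_one (T := T) (j := j)
      (by rintro (i | i) h <;> exact h) (by simp [hT]) hM
    have hEM := mul_mem (genGroup_inf_basisFixer_le T hE) hM
    obtain ⟨F, hF, hl⟩ := exists_clear_col hEM (by simp [hT]) hone
    have hFEM := mul_mem (genGroup_inf_basisFixer_le T hF) hEM
    obtain ⟨K, hK, hr⟩ := exists_clear_col (y := Sum.inr j) ⟨hFEM.1, hl⟩ (by simp [hT])
      ((apply_eq_one_apply_of_swap_mem hl (Set.mem_insert _ _) _).trans (one_apply_eq _))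
    have hmem : K * (F * (E * M)) ∈ genGroup g := by
      refine ih ⟨mul_mem (genGroup_le_Gamma2 hK.1) hFEM.1, fun y hy => hr y ?_⟩
      rcases y with i | i <;> by_cases hi : i = j <;> simp_all
    rwa [Subgroup.mul_mem_cancel_left _ hK.1, Subgroup.mul_mem_cancel_left _ hF.1,
      Subgroup.mul_mem_cancel_left _ hE.1] at hmem

theorem genGroup_eq_Gamma2 : genGroup g = Gamma2 g :=
  le_antisymm genGroup_le_Gamma2 fun M hM =>
    mem_genGroup_of_mem_basisFixer Finset.univ ⟨hM, by simp [basisFixer]⟩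

end Elimination

/-! ### The abelianization -/

section Abelianization

theorem orderedProd_mem {H : Subgroup (Sp g)} {X : Fin g → Fin g → Sp g} (hX : ∀ i j, X i j ∈ H)
    (l : List (Fin g × Fin g)) (k : Fin g → Fin g → ℤ) : orderedProd l X k ∈ H := by
  refine H.list_prod_mem fun M hM => ?_
  obtain ⟨x, -, rfl⟩ := List.mem_map.1 hM
  exact zpow_mem (hX _ _) _

variable {H : Subgroup (Sp g)} {X : Fin g → Fin g → Sp g} {l : List (Fin g × Fin g)}
  {α : Type*} [CommGroup α]

theorem map_orderedProd (f : H →* α) (hX : ∀ i j, X i j ∈ H) (hl : l.Nodup)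
    (k : Fin g → Fin g → ℤ) :
    f ⟨orderedProd l X k, orderedProd_mem hX l k⟩
      = ∏ x ∈ l.toFinset, f ⟨X x.1 x.2, hX x.1 x.2⟩ ^ k x.1 x.2 := by
  rw [List.prod_toFinset _ hl]
  clear hl
  induction l with
  | nil => exact f.map_one
  | cons x l ih =>
    rw [List.map_cons, List.prod_cons, ← ih, ← map_zpow, ← map_mul]
    rfl

theorem exists_map_orderedProd_eq (f : H →* α) (hX : ∀ i j, X i j ∈ H) (hl : l.Nodup) {y : α}
    (hy : y ∈ Subgroup.closure {y | ∃ x ∈ l, f ⟨X x.1 x.2, hX x.1 x.2⟩ = y}) :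
    ∃ k, f ⟨orderedProd l X k, orderedProd_mem hX l k⟩ = y := by
  simp only [map_orderedProd f hX hl]
  induction hy using Subgroup.closure_induction with
  | mem y h =>
    obtain ⟨x, hx, rfl⟩ := h
    refine ⟨fun i j => if (i, j) = x then 1 else 0, ?_⟩
    rw [Finset.prod_eq_single_of_mem x (List.mem_toFinset.2 hx) fun y _ hy => by simp [hy]]
    simp
  | one => exact ⟨0, by simp⟩
  | mul y y' _ _ ih ih' =>
    obtain ⟨⟨k, rfl⟩, k', rfl⟩ := And.intro ih ih'
    exact ⟨k + k', by simp [_root_.zpow_add, Finset.prod_mul_distrib]⟩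
  | inv y _ ih =>
    obtain ⟨k, rfl⟩ := ih
    exact ⟨-k, by simp⟩

theorem B_comm (i j : Fin g) : B i j = B j i := by
  have hgen : genB i j = genB j i := by
    rw [← genB_transpose j i]
    ext k l
    simp [genB, and_comm]
  simp only [B, hgen]

theorem C_comm (i j : Fin g) : C i j = C j i := by
  simp only [C, B_comm i j]

theorem exists_map_eq_mul_orderedProd (f : Gamma2 g →* α) {lA lB lC : List (Fin g × Fin g)}
    (hA : Enumerates lA fun _ _ => True) (hB : Enumerates lB fun i j => i ≤ j)
    (hC : Enumerates lC fun i j => i ≤ j) (M : Gamma2 g) :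
    ∃ p q r, f M = f ⟨orderedProd lA A p, orderedProd_mem A_mem_Gamma2 lA p⟩
      * f ⟨orderedProd lB B q, orderedProd_mem B_mem_Gamma2 lB q⟩
      * f ⟨orderedProd lC C r, orderedProd_mem C_mem_Gamma2 lC r⟩ := by
  let SA := Subgroup.closure {y | ∃ x ∈ lA, f ⟨A x.1 x.2, A_mem_Gamma2 _ _⟩ = y}
  let SB := Subgroup.closure {y | ∃ x ∈ lB, f ⟨B x.1 x.2, B_mem_Gamma2 _ _⟩ = y}
  let SC := Subgroup.closure {y | ∃ x ∈ lC, f ⟨C x.1 x.2, C_mem_Gamma2 _ _⟩ = y}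
  have hAS (i j) : f ⟨A i j, A_mem_Gamma2 i j⟩ ∈ SA :=
    Subgroup.subset_closure ⟨(i, j), (hA.2 _).2 trivial, rfl⟩
  have hBS (i j) : f ⟨B i j, B_mem_Gamma2 i j⟩ ∈ SB := by
    rcases le_total i j with hij | hij
    · exact Subgroup.subset_closure ⟨(i, j), (hB.2 _).2 hij, rfl⟩
    · exact Subgroup.subset_closure ⟨(j, i), (hB.2 _).2 hij, by simp only [B_comm]⟩
  have hCS (i j) : f ⟨C i j, C_mem_Gamma2 i j⟩ ∈ SC := by
    rcases le_total i j with hij | hij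
    · exact Subgroup.subset_closure ⟨(i, j), (hC.2 _).2 hij, rfl⟩
    · exact Subgroup.subset_closure ⟨(j, i), (hC.2 _).2 hij, by simp only [C_comm]⟩
  have hle : genGroup g ≤ ((SA ⊔ SB ⊔ SC).comap f).map (Gamma2 g).subtype :=
    genGroup_le (fun i j => ⟨_, Subgroup.mem_sup_left (Subgroup.mem_sup_left (hAS i j)), rfl⟩)
      (fun i j => ⟨_, Subgroup.mem_sup_left (Subgroup.mem_sup_right (hBS i j)), rfl⟩)
      (fun i j => ⟨_, Subgroup.mem_sup_right (hCS i j), rfl⟩)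
  obtain ⟨N, hN, hNM⟩ := hle (by rw [genGroup_eq_Gamma2]; exact M.2)
  obtain ⟨y, hy, c, hc, hyc⟩ := Subgroup.mem_sup.1 hN
  obtain ⟨a, ha, b, hb, rfl⟩ := Subgroup.mem_sup.1 hy
  obtain ⟨p, rfl⟩ := exists_map_orderedProd_eq f A_mem_Gamma2 hA.1 ha
  obtain ⟨q, rfl⟩ := exists_map_orderedProd_eq f B_mem_Gamma2 hB.1 hb
  obtain ⟨r, rfl⟩ := exists_map_orderedProd_eq f C_mem_Gamma2 hC.1 hc
  exact ⟨p, q, r, hyc ▸ congrArg f (Subtype.ext hNM.symm)⟩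

theorem exists_decomposition {lA lB lC : List (Fin g × Fin g)}
    (hA : Enumerates lA fun _ _ => True) (hB : Enumerates lB fun i j => i ≤ j)
    (hC : Enumerates lC fun i j => i ≤ j) {M : Sp g} (hM : M ∈ Gamma2 g) :
    ∃ p q r, ∃ M' ∈ ⁅Gamma2 g, Gamma2 g⁆,
      M = orderedProd lA A p * orderedProd lB B q * orderedProd lC C r * M' := by
  obtain ⟨p, q, r, h⟩ := exists_map_eq_mul_orderedProd Abelianization.of hA hB hC ⟨M, hM⟩
  let P : Gamma2 g := ⟨orderedProd lA A p, orderedProd_mem A_mem_Gamma2 _ _⟩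
    * ⟨orderedProd lB B q, orderedProd_mem B_mem_Gamma2 _ _⟩
    * ⟨orderedProd lC C r, orderedProd_mem C_mem_Gamma2 _ _⟩
  have hker : P⁻¹ * ⟨M, hM⟩ ∈ commutator (Gamma2 g) := by
    rw [← Abelianization.ker_of, MonoidHom.mem_ker, map_mul, map_inv, h, map_mul, map_mul,
      inv_mul_cancel]
  refine ⟨p, q, r, P.1⁻¹ * M, ?_, (mul_inv_cancel_left P.1 M).symm⟩
  rw [← Subgroup.map_subtype_commutator]
  exact ⟨_, hker, rfl⟩

theorem chiExp_A (m : Characteristic g) (i j : Fin g) :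
    chiExp m (A i j) = -2 * (m (Sum.inl i) * m (Sum.inr j)) := by
  by_cases h : i = j
  · subst h
    have hcoe : (A i i).1 = 1 + (2 : ℤ) •
        diagonal (Sum.elim (Pi.single i (-1)) (Pi.single i (-1))) := by
      rw [coe_A_self, ← diagonal_one, ← diagonal_smul, diagonal_add]
      congr 1
      ext (x | x) <;> by_cases hx : x = i <;> simp [hx]
    simp [chiExp, halfDiff, half_eq hcoe, symp_apply, quad, dotProduct, mulVec_diagonal,
      Pi.single_apply]
    ring
  · simp [chiExp, halfDiff, half_eq (coe_A_of_ne h), elemStep, dualCoeff, symp_apply, quad,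
      dotProduct, mulVec, single_apply, ite_and, Ne.symm h]
    ring

theorem chiExp_B (m : Characteristic g) (i j : Fin g) :
    chiExp m (B i j) = (if i = j then 1 else 2) * (m (Sum.inl i) * m (Sum.inl j)) := by
  by_cases h : i = j
  · subst h
    simp [chiExp, halfDiff, half_eq (coe_B i i), elemStep, dualCoeff, symp_apply, quad,
      dotProduct, mulVec, single_apply, ite_and]
  · simp [chiExp, halfDiff, half_eq (coe_B i j), elemStep, dualCoeff, symp_apply, quad,
      dotProduct, mulVec, single_apply, ite_and, h, add_mul, mul_add, Finset.sum_add_distrib]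
    ring

theorem chiExp_C (m : Characteristic g) (i j : Fin g) :
    chiExp m (C i j) = -(if i = j then 1 else 2) * (m (Sum.inr i) * m (Sum.inr j)) := by
  by_cases h : i = j
  · subst h
    simp [chiExp, halfDiff, half_eq (coe_C i i), elemStep, dualCoeff, symp_apply, quad,
      dotProduct, mulVec, single_apply, ite_and]
  · simp [chiExp, halfDiff, half_eq (coe_C i j), elemStep, dualCoeff, symp_apply, quad,
      dotProduct, mulVec, single_apply, ite_and, h, add_mul, mul_add, Finset.sum_add_distrib]
    ring

theorem chiExp_orderedProd (m : Characteristic g) (hX : ∀ i j, X i j ∈ Gamma2 g)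
    {P : Fin g → Fin g → Prop} [∀ i j, Decidable (P i j)] (hl : Enumerates l P)
    (k : Fin g → Fin g → ℤ) :
    (chiExp m (orderedProd l X k) : ZMod 4)
      = ∑ i, ∑ j, if P i j then (k i j * chiExp m (X i j) : ZMod 4) else 0 := by
  have hfilter : l.toFinset = Finset.univ.filter fun x => P x.1 x.2 := by
    ext x; simp [hl.2 x]
  have h := congrArg Multiplicative.toAdd (map_orderedProd (chiHom m) hX hl.1 k)
  rw [toAdd_prod, hfilter, Finset.sum_filter, Fintype.sum_prod_type] at h
  simp only [toAdd_zpow, zsmul_eq_mul] at h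
  exact h

theorem chiExp_decomposition {lA lB lC : List (Fin g × Fin g)}
    (hA : Enumerates lA fun _ _ => True) (hB : Enumerates lB fun i j => i ≤ j)
    (hC : Enumerates lC fun i j => i ≤ j) (p q r : Fin g → Fin g → ℤ) {M' : Sp g}
    (hM' : M' ∈ ⁅Gamma2 g, Gamma2 g⁆) (m : Characteristic g) :
    (chiExp m (orderedProd lA A p * orderedProd lB B q * orderedProd lC C r * M') : ZMod 4)
      = 2 * expA p q r m - expB q r m := by
  have hMA := orderedProd_mem (g := g) A_mem_Gamma2 lA p
  have hMB := orderedProd_mem (g := g) B_mem_Gamma2 lB q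
  have hMC := orderedProd_mem (g := g) C_mem_Gamma2 lC r
  have hM := commutator_le_self _ hM'
  have hzero : (chiExp m M' : ZMod 4) = 0 := map_eq_one_of_mem_commutator (chiHom m) hM hM'
  rw [chiExp_mul m (mul_mem (mul_mem hMA hMB) hMC) hM, chiExp_mul m (mul_mem hMA hMB) hMC,
    chiExp_mul m hMA hMB, hzero, add_zero, chiExp_orderedProd m A_mem_Gamma2 hA,
    chiExp_orderedProd m B_mem_Gamma2 hB, chiExp_orderedProd m C_mem_Gamma2 hC, expA, expB]
  have hdiag (F : Fin g → ZMod 4) : ∑ i, F i = ∑ i, ∑ j, if i = j then F i else 0 := by simp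
  push_cast
  rw [hdiag fun i => q i i * m (Sum.inl i) ^ 2, hdiag fun i => r i i * m (Sum.inr i) ^ 2]
  simp only [mul_add, Finset.mul_sum, ← Finset.sum_add_distrib, ← Finset.sum_sub_distrib]
  refine Finset.sum_congr rfl fun i _ => Finset.sum_congr rfl fun j _ => ?_
  have hfour : (4 : ZMod 4) = 0 := rfl
  rw [chiExp_A, chiExp_B, chiExp_C]
  rcases lt_trichotomy i j with hij | rfl | hij
  · simp [hij, hij.le, hij.ne]
    linear_combination (-(p i j : ZMod 4) * m (Sum.inl i) * m (Sum.inr j)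
      - (r i j : ZMod 4) * m (Sum.inr i) * m (Sum.inr j)) * hfour
  · simp
    linear_combination (-(p i i : ZMod 4) * m (Sum.inl i) * m (Sum.inr i)) * hfour
  · simp [hij.not_ge, hij.not_gt, hij.ne']
    linear_combination (-(p i j : ZMod 4) * m (Sum.inl i) * m (Sum.inr j)) * hfour

end Abelianization

/-! ### The action on the Siegel upper half-space -/

section HalfSpace

theorem toC_mul (X Y : Matrix (Fin g) (Fin g) ℤ) : toC (X * Y) = toC X * toC Y :=
  map_mul (Int.castRingHom ℂ).mapMatrix X Y

theorem toC_add (X Y : Matrix (Fin g) (Fin g) ℤ) : toC (X + Y) = toC X + toC Y :=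
  map_add (Int.castRingHom ℂ).mapMatrix X Y

theorem toC_sub (X Y : Matrix (Fin g) (Fin g) ℤ) : toC (X - Y) = toC X - toC Y :=
  map_sub (Int.castRingHom ℂ).mapMatrix X Y

theorem toC_one : toC (1 : Matrix (Fin g) (Fin g) ℤ) = 1 :=
  map_one (Int.castRingHom ℂ).mapMatrix

theorem toC_zero : toC (0 : Matrix (Fin g) (Fin g) ℤ) = 0 :=
  map_zero (Int.castRingHom ℂ).mapMatrix

theorem toC_transpose (X : Matrix (Fin g) (Fin g) ℤ) : toC Xᵀ = (toC X)ᵀ := rfl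

theorem toC_conjTranspose (X : Matrix (Fin g) (Fin g) ℤ) : (toC X)ᴴ = (toC X)ᵀ := by
  ext i j; simp [toC]

theorem coe_eq_fromBlocks (M : Sp g) :
    M.1 = fromBlocks (blkA M) (blkB M) (blkC M) (blkD M) := (fromBlocks_toBlocks M.1).symm

theorem coe_inv_eq_fromBlocks (M : Sp g) :
    (M⁻¹).1 = fromBlocks (blkD M)ᵀ (-(blkB M)ᵀ) (-(blkC M)ᵀ) (blkA M)ᵀ := by
  rw [SymplecticGroup.coe_inv, coe_eq_fromBlocks M]
  simp [J, fromBlocks_multiply, fromBlocks_transpose, fromBlocks_neg]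

theorem blk_relations (M : Sp g) :
    (blkD M)ᵀ * blkA M - (blkB M)ᵀ * blkC M = 1 ∧ (blkD M)ᵀ * blkB M = (blkB M)ᵀ * blkD M ∧
      (blkA M)ᵀ * blkC M = (blkC M)ᵀ * blkA M ∧ (blkA M)ᵀ * blkD M - (blkC M)ᵀ * blkB M = 1 := by
  have h : (M⁻¹).1 * M.1 = 1 := congrArg Subtype.val (inv_mul_cancel M)
  rw [coe_inv_eq_fromBlocks, coe_eq_fromBlocks M, fromBlocks_multiply, ← fromBlocks_one,
    fromBlocks_inj] at h
  simpa only [neg_mul, ← sub_eq_add_neg, neg_add_eq_sub, sub_eq_zero] using h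

theorem blk_mul (M N : Sp g) :
    blkA (M * N) = blkA M * blkA N + blkB M * blkC N ∧
    blkB (M * N) = blkA M * blkB N + blkB M * blkD N ∧
    blkC (M * N) = blkC M * blkA N + blkD M * blkC N ∧
    blkD (M * N) = blkC M * blkB N + blkD M * blkD N := by
  rw [← fromBlocks_inj, ← fromBlocks_multiply, ← coe_eq_fromBlocks, ← coe_eq_fromBlocks,
    ← coe_eq_fromBlocks, Submonoid.coe_mul]

theorem blk_one : blkA (1 : Sp g) = 1 ∧ blkB (1 : Sp g) = 0 ∧ blkC (1 : Sp g) = 0 ∧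
    blkD (1 : Sp g) = 1 := by
  rw [← fromBlocks_inj, ← coe_eq_fromBlocks, fromBlocks_one, Submonoid.coe_one]

theorem toC_relations (M : Sp g) :
    (toC (blkD M))ᵀ * toC (blkA M) - (toC (blkB M))ᵀ * toC (blkC M) = 1 ∧
    (toC (blkD M))ᵀ * toC (blkB M) = (toC (blkB M))ᵀ * toC (blkD M) ∧
    (toC (blkA M))ᵀ * toC (blkC M) = (toC (blkC M))ᵀ * toC (blkA M) ∧
    (toC (blkA M))ᵀ * toC (blkD M) - (toC (blkC M))ᵀ * toC (blkB M) = 1 := by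
  obtain ⟨h1, h2, h3, h4⟩ := blk_relations M
  simp only [← toC_transpose, ← toC_mul, ← toC_sub, h1, h2, h3, h4, toC_one, and_self]

/-- The numerator `aτ + b` of `Mτ`. -/
def actNum (M : Sp g) (τ : Matrix (Fin g) (Fin g) ℂ) : Matrix (Fin g) (Fin g) ℂ :=
  toC (blkA M) * τ + toC (blkB M)

theorem act_eq (M : Sp g) (τ : Matrix (Fin g) (Fin g) ℂ) :
    act M τ = actNum M τ * (autFactor M τ)⁻¹ := rfl

theorem autFactor_transpose_mul_actNum (M : Sp g) {τ : Matrix (Fin g) (Fin g) ℂ} (hτ : τᵀ = τ) :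
    (autFactor M τ)ᵀ * actNum M τ = (actNum M τ)ᵀ * autFactor M τ := by
  obtain ⟨hda, hdb, hac, had⟩ := toC_relations M
  simp only [autFactor, actNum, transpose_add, transpose_mul, hτ]
  linear_combination (norm := noncomm_ring) hdb + hda * τ - τ * had
    + (-1 : Matrix (Fin g) (Fin g) ℂ) * τ * hac * τ

theorem autFactor_conjTranspose_mul_actNum (M : Sp g) (τ : Matrix (Fin g) (Fin g) ℂ) :
    (autFactor M τ)ᴴ * actNum M τ - (actNum M τ)ᴴ * autFactor M τ = τ - τᴴ := by
  obtain ⟨hda, hdb, hac, had⟩ := toC_relations M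
  simp only [autFactor, actNum, conjTranspose_add, conjTranspose_mul, toC_conjTranspose]
  linear_combination (norm := noncomm_ring) hdb + hda * τ - τᴴ * had
    + (-1 : Matrix (Fin g) (Fin g) ℂ) * τᴴ * hac * τ

theorem im_dotProduct_mulVec_ofReal (τ : Matrix (Fin g) (Fin g) ℂ) (x : Fin g → ℝ) :
    ((fun i => (x i : ℂ)) ⬝ᵥ τ *ᵥ fun i => (x i : ℂ)).im = x ⬝ᵥ τ.map Complex.im *ᵥ x := by
  simp [dotProduct, mulVec, Complex.im_sum]

theorem im_star_dotProduct {τ : Matrix (Fin g) (Fin g) ℂ} (hτ : τᵀ = τ) (v : Fin g → ℂ) :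
    (star v ⬝ᵥ τ *ᵥ v).im =
      (fun i => (v i).re) ⬝ᵥ (τ.map Complex.im *ᵥ fun i => (v i).re) +
        (fun i => (v i).im) ⬝ᵥ (τ.map Complex.im *ᵥ fun i => (v i).im) := by
  set x : Fin g → ℂ := fun i => ((v i).re : ℂ)
  set y : Fin g → ℂ := fun i => ((v i).im : ℂ)
  have hv : v = x + Complex.I • y := by
    ext i; simp [x, y, mul_comm Complex.I]
  have hstar : star v = x - Complex.I • y := by
    rw [hv]; ext i; simp [x, y, sub_eq_add_neg]
  have hsymm : x ⬝ᵥ τ *ᵥ y = y ⬝ᵥ τ *ᵥ x := by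
    rw [dotProduct_mulVec, ← mulVec_transpose, hτ, dotProduct_comm]
  have hsplit : star v ⬝ᵥ τ *ᵥ v = x ⬝ᵥ τ *ᵥ x + y ⬝ᵥ τ *ᵥ y := by
    rw [hstar, hv]
    simp only [mulVec_add, mulVec_smul, dotProduct_add, sub_dotProduct, dotProduct_smul,
      smul_dotProduct, smul_eq_mul, hsymm]
    linear_combination -(y ⬝ᵥ τ *ᵥ y) * Complex.I_sq
  rw [hsplit, Complex.add_im, im_dotProduct_mulVec_ofReal, im_dotProduct_mulVec_ofReal]

theorem mem_siegelUpperHalf_iff {τ : Matrix (Fin g) (Fin g) ℂ} :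
    τ ∈ SiegelUpperHalf g ↔ τᵀ = τ ∧ ∀ v : Fin g → ℂ, v ≠ 0 → 0 < (star v ⬝ᵥ τ *ᵥ v).im := by
  refine and_congr_right fun hτ => ⟨fun hpos v hv => ?_, fun hpos => ?_⟩
  · have hnonneg (x : Fin g → ℝ) : 0 ≤ x ⬝ᵥ (τ.map Complex.im *ᵥ x) := by
      simpa using hpos.posSemidef.dotProduct_mulVec_nonneg x
    have hpos' (x : Fin g → ℝ) (hx : x ≠ 0) : 0 < x ⬝ᵥ (τ.map Complex.im *ᵥ x) := by
      simpa using hpos.dotProduct_mulVec_pos hx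
    rw [im_star_dotProduct hτ]
    by_cases hre : (fun i => (v i).re) = 0
    · refine add_pos_of_nonneg_of_pos (hnonneg _) (hpos' _ fun him => hv ?_)
      ext i
      exact Complex.ext (congrFun hre i) (congrFun him i)
    · exact add_pos_of_pos_of_nonneg (hpos' _ hre) (hnonneg _)
  · refine PosDef.of_dotProduct_mulVec_pos ?_ fun x hx => ?_
    · ext i j
      simp [← congrFun₂ hτ i j]
    · have hx' : (fun i => (x i : ℂ)) ≠ 0 := fun h => hx (by ext i; simpa using congrFun h i)
      have hstar : star (fun i => (x i : ℂ)) = fun i => (x i : ℂ) := by ext i; simp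
      simpa [hstar, im_dotProduct_mulVec_ofReal] using hpos _ hx'

theorem im_star_dotProduct_congr {X Y : Matrix (Fin g) (Fin g) ℂ} (h : X - Xᴴ = Y - Yᴴ)
    (v : Fin g → ℂ) : (star v ⬝ᵥ X *ᵥ v).im = (star v ⬝ᵥ Y *ᵥ v).im := by
  have hconj (Z : Matrix (Fin g) (Fin g) ℂ) :
      (star v ⬝ᵥ Zᴴ *ᵥ v).im = -(star v ⬝ᵥ Z *ᵥ v).im := by
    rw [dotProduct_mulVec, ← star_mulVec, star_dotProduct]
    exact Complex.conj_im _
  have hv := congrArg (fun Z => (star v ⬝ᵥ Z *ᵥ v).im) h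
  simp only [sub_mulVec, dotProduct_sub, Complex.sub_im, hconj] at hv
  linarith

theorem star_dotProduct_actNum (M : Sp g) (τ : Matrix (Fin g) (Fin g) ℂ) (v : Fin g → ℂ) :
    (star (autFactor M τ *ᵥ v) ⬝ᵥ actNum M τ *ᵥ v).im = (star v ⬝ᵥ τ *ᵥ v).im := by
  rw [star_mulVec, ← dotProduct_mulVec, mulVec_mulVec]
  refine im_star_dotProduct_congr ?_ v
  rw [conjTranspose_mul, conjTranspose_conjTranspose, autFactor_conjTranspose_mul_actNum]

variable {τ : Matrix (Fin g) (Fin g) ℂ}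

theorem isUnit_det_autFactor (M : Sp g) (hτ : τ ∈ SiegelUpperHalf g) :
    IsUnit (autFactor M τ).det := by
  refine isUnit_iff_ne_zero.2 fun h0 => ?_
  obtain ⟨v, hv, hv0⟩ := exists_mulVec_eq_zero_iff.2 h0
  have h := (mem_siegelUpperHalf_iff.1 hτ).2 v hv
  simp [← star_dotProduct_actNum M, hv0] at h

theorem act_mul_autFactor (M : Sp g) (hτ : τ ∈ SiegelUpperHalf g) :
    act M τ * autFactor M τ = actNum M τ :=
  nonsing_inv_mul_cancel_right _ _ (isUnit_det_autFactor M hτ)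

theorem act_transpose (M : Sp g) (hτ : τ ∈ SiegelUpperHalf g) : (act M τ)ᵀ = act M τ := by
  have hu := isUnit_det_autFactor M hτ
  have hut : IsUnit (autFactor M τ)ᵀ.det := by rwa [det_transpose]
  calc (act M τ)ᵀ = ((autFactor M τ)ᵀ)⁻¹ * (actNum M τ)ᵀ := by
        rw [act_eq, transpose_mul, transpose_nonsing_inv]
    _ = ((autFactor M τ)ᵀ)⁻¹ * ((actNum M τ)ᵀ * autFactor M τ) * (autFactor M τ)⁻¹ := by
        rw [mul_assoc, mul_nonsing_inv_cancel_right _ _ hu]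
    _ = act M τ := by
        rw [← autFactor_transpose_mul_actNum M hτ.1, nonsing_inv_mul_cancel_left _ _ hut, act_eq]

theorem act_mem (M : Sp g) (hτ : τ ∈ SiegelUpperHalf g) : act M τ ∈ SiegelUpperHalf g := by
  refine mem_siegelUpperHalf_iff.2 ⟨act_transpose M hτ, fun v hv => ?_⟩
  have hw : autFactor M τ *ᵥ ((autFactor M τ)⁻¹ *ᵥ v) = v := by
    rw [mulVec_mulVec, mul_nonsing_inv _ (isUnit_det_autFactor M hτ), one_mulVec]
  have hw0 : (autFactor M τ)⁻¹ *ᵥ v ≠ 0 := fun h0 => hv (by rw [← hw, h0, mulVec_zero])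
  have h := (mem_siegelUpperHalf_iff.1 hτ).2 _ hw0
  rwa [← star_dotProduct_actNum M, hw, mulVec_mulVec, ← act_eq] at h

theorem autFactor_mul (M N : Sp g) (hτ : τ ∈ SiegelUpperHalf g) :
    autFactor (M * N) τ = autFactor M (act N τ) * autFactor N τ := by
  obtain ⟨-, -, hc, hd⟩ := blk_mul M N
  rw [autFactor, autFactor, add_mul, mul_assoc, act_mul_autFactor N hτ, hc, hd]
  simp only [toC_add, toC_mul, actNum, autFactor]
  noncomm_ring

theorem actNum_mul (M N : Sp g) (hτ : τ ∈ SiegelUpperHalf g) :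
    actNum (M * N) τ = actNum M (act N τ) * autFactor N τ := by
  obtain ⟨ha, hb, -, -⟩ := blk_mul M N
  rw [actNum, actNum, add_mul, mul_assoc, act_mul_autFactor N hτ, ha, hb]
  simp only [toC_add, toC_mul, actNum, autFactor]
  noncomm_ring

theorem act_mul (M N : Sp g) (hτ : τ ∈ SiegelUpperHalf g) :
    act (M * N) τ = act M (act N τ) := by
  rw [act_eq, actNum_mul M N hτ, autFactor_mul M N hτ, Matrix.mul_inv_rev, ← mul_assoc,
    mul_nonsing_inv_cancel_right _ _ (isUnit_det_autFactor N hτ), ← act_eq]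

theorem autFactor_one (τ : Matrix (Fin g) (Fin g) ℂ) : autFactor 1 τ = 1 := by
  simp [autFactor, blk_one, toC_one, toC_zero]

theorem act_one (τ : Matrix (Fin g) (Fin g) ℂ) : act 1 τ = τ := by
  simp [act, autFactor_one, blk_one, toC_one, toC_zero]

theorem autFactor_inv_transpose (M : Sp g) (hτ : τ ∈ SiegelUpperHalf g) :
    ((autFactor M τ)⁻¹)ᵀ = toC (blkA M) - act M τ * toC (blkC M) := by
  have hact : (autFactor M τ)ᵀ * act M τ = (actNum M τ)ᵀ := by
    rw [← act_mul_autFactor M hτ, transpose_mul, act_transpose M hτ]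
  obtain ⟨hda, -, hac, -⟩ := toC_relations M
  rw [transpose_nonsing_inv]
  refine inv_eq_right_inv ?_
  rw [mul_sub, ← mul_assoc, hact]
  simp only [autFactor, actNum, transpose_add, transpose_mul, hτ.1]
  linear_combination (norm := noncomm_ring) hda - τ * hac

theorem continuous_autFactor (M : Sp g) : Continuous (autFactor M) := by
  unfold autFactor
  fun_prop

theorem continuousOn_act (M : Sp g) : ContinuousOn (act M) (SiegelUpperHalf g) := by
  have hinv : ContinuousOn (fun τ => (autFactor M τ)⁻¹) (SiegelUpperHalf g) := by
    simp only [inv_def, Ring.inverse_eq_inv']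
    exact ((continuous_autFactor M).matrix_det.continuousOn.inv₀ fun τ hτ =>
      (isUnit_det_autFactor M hτ).ne_zero).smul
        (continuous_autFactor M).matrix_adjugate.continuousOn
  have hnum : Continuous (actNum M) := by
    unfold actNum
    fun_prop
  exact hnum.continuousOn.mul hinv

end HalfSpace

/-! ### Theta series -/

section ThetaSeries

/-- `exp(πix)`, the exponential in the general term of a theta series; `e(x) = expPi (2x)`. -/
def expPi (x : ℂ) : ℂ := Complex.exp (Real.pi * Complex.I * x)

theorem e_eq_expPi (x : ℂ) : e x = expPi (2 * x) := by
  rw [e, expPi]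
  congr 1
  ring

theorem expPi_add (x y : ℂ) : expPi (x + y) = expPi x * expPi y := by
  rw [expPi, mul_add, Complex.exp_add, expPi, expPi]

theorem expPi_ne_zero (x : ℂ) : expPi x ≠ 0 := Complex.exp_ne_zero _

theorem expPi_add_two_mul_int (x : ℂ) (k : ℤ) : expPi (x + 2 * k) = expPi x := by
  have h : expPi (2 * k) = 1 := Complex.exp_eq_one_iff.2 ⟨k, by ring⟩
  rw [expPi_add, h, mul_one]

theorem norm_expPi (x : ℂ) : ‖expPi x‖ = Real.exp (-Real.pi * x.im) := by
  simp [expPi, Complex.norm_exp]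

/-- An integral vector as a complex vector. -/
def castV (p : Fin g → ℤ) : Fin g → ℂ := fun i => (p i : ℂ)

theorem castV_add (p q : Fin g → ℤ) : castV (p + q) = castV p + castV q := by
  ext i; simp [castV]

theorem castV_two_smul (p : Fin g → ℤ) : castV ((2 : ℤ) • p) = (2 : ℂ) • castV p := by
  ext i; simp [castV, -zsmul_eq_mul]

theorem dotProduct_castV (p q : Fin g → ℤ) : castV p ⬝ᵥ castV q = ((p ⬝ᵥ q : ℤ) : ℂ) := by
  simp [castV, dotProduct]

theorem toC_mulVec_castV (X : Matrix (Fin g) (Fin g) ℤ) (p : Fin g → ℤ) :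
    toC X *ᵥ castV p = castV (X *ᵥ p) := by
  ext i
  simp [castV, toC, mulVec, dotProduct]

/-- The complex vector `m'`. -/
def fstV (m : Characteristic g) : Fin g → ℂ := castV (m ∘ Sum.inl)

/-- The complex vector `m''`. -/
def sndV (m : Characteristic g) : Fin g → ℂ := castV (m ∘ Sum.inr)

theorem fstV_dotProduct_sndV (m : Characteristic g) : fstV m ⬝ᵥ sndV m = (quad m : ℂ) :=
  dotProduct_castV _ _

/-- `exp πi(ᵗv τ v + 2 ᵗv z)`; the general term of `θ_m(τ, z)` is obtained for `v = p + m'/2`, with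
`z` replaced by `z + m''/2`. -/
def thetaTerm (τ : Matrix (Fin g) (Fin g) ℂ) (z v : Fin g → ℂ) : ℂ :=
  expPi (v ⬝ᵥ τ *ᵥ v + 2 * (v ⬝ᵥ z))

theorem dotProduct_mulVec_comm {τ : Matrix (Fin g) (Fin g) ℂ} (hτ : τᵀ = τ) (u v : Fin g → ℂ) :
    u ⬝ᵥ τ *ᵥ v = v ⬝ᵥ τ *ᵥ u := by
  rw [dotProduct_mulVec, ← mulVec_transpose, hτ, dotProduct_comm]

theorem thetaTerm_add {τ : Matrix (Fin g) (Fin g) ℂ} (hτ : τᵀ = τ) (z u v : Fin g → ℂ) :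
    thetaTerm τ z (v + u) = thetaTerm τ z u * thetaTerm τ (z + τ *ᵥ u) v := by
  rw [thetaTerm, thetaTerm, thetaTerm, ← expPi_add]
  congr 1
  simp only [mulVec_add, dotProduct_add, add_dotProduct, dotProduct_mulVec_comm hτ u v]
  ring

theorem theta_eq_tsum (m : Characteristic g) (τ : Matrix (Fin g) (Fin g) ℂ) (z : Fin g → ℂ) :
    theta m τ z = ∑' p : Fin g → ℤ,
      thetaTerm τ (z + (1 / 2 : ℂ) • sndV m) (castV p + (1 / 2 : ℂ) • fstV m) := by
  have hv (p : Fin g → ℤ) : castV p + (1 / 2 : ℂ) • fstV m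
      = fun i => (p i : ℂ) + (m (Sum.inl i) : ℂ) / 2 := by
    ext i; simp [castV, fstV]; ring
  have hz : z + (1 / 2 : ℂ) • sndV m = fun i => z i + (m (Sum.inr i) : ℂ) / 2 := by
    ext i; simp [castV, sndV]; ring
  simp only [hv, hz]
  rfl

/-- The theta function of characteristic zero. -/
def thetaZero (τ : Matrix (Fin g) (Fin g) ℂ) (z : Fin g → ℂ) : ℂ :=
  ∑' p : Fin g → ℤ, thetaTerm τ z (castV p)

/-- `τm' + m''`, which is twice the translation that carries `θ_0` to `θ_m`. -/
def periodVec (τ : Matrix (Fin g) (Fin g) ℂ) (m : Characteristic g) : Fin g → ℂ :=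
  τ *ᵥ fstV m + sndV m

theorem theta_eq_thetaZero (m : Characteristic g) {τ : Matrix (Fin g) (Fin g) ℂ} (hτ : τᵀ = τ)
    (z : Fin g → ℂ) :
    theta m τ z = thetaTerm τ (z + (1 / 2 : ℂ) • sndV m) ((1 / 2 : ℂ) • fstV m)
      * thetaZero τ (z + (1 / 2 : ℂ) • periodVec τ m) := by
  have hz : z + (1 / 2 : ℂ) • periodVec τ m
      = z + (1 / 2 : ℂ) • sndV m + τ *ᵥ ((1 / 2 : ℂ) • fstV m) := by
    rw [periodVec, smul_add, mulVec_smul]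
    abel
  simp only [theta_eq_tsum, thetaZero, thetaTerm_add hτ, tsum_mul_left, hz]

theorem thetaTerm_add_right (τ : Matrix (Fin g) (Fin g) ℂ) (z w v : Fin g → ℂ) :
    thetaTerm τ (z + w) v = thetaTerm τ z v * expPi (2 * (v ⬝ᵥ w)) := by
  rw [thetaTerm, thetaTerm, ← expPi_add, dotProduct_add, mul_add, add_assoc]

theorem theta_add_two_smul (m n : Characteristic g) (τ : Matrix (Fin g) (Fin g) ℂ)
    (z : Fin g → ℂ) :
    theta (m + (2 : ℤ) • n) τ z
      = expPi (((m ∘ Sum.inl) ⬝ᵥ (n ∘ Sum.inr) : ℤ)) * theta m τ z := by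
  have hfst : fstV (m + (2 : ℤ) • n) = fstV m + (2 : ℂ) • fstV n := by
    rw [fstV, fstV, fstV, ← castV_two_smul, ← castV_add]; rfl
  have hsnd : sndV (m + (2 : ℤ) • n) = sndV m + (2 : ℂ) • sndV n := by
    rw [sndV, sndV, sndV, ← castV_two_smul, ← castV_add]; rfl
  have hz : z + (1 / 2 : ℂ) • sndV (m + (2 : ℤ) • n) = z + (1 / 2 : ℂ) • sndV m + sndV n := by
    rw [hsnd]; module
  rw [theta_eq_tsum, theta_eq_tsum, ← tsum_mul_left]
  refine Eq.trans (tsum_congr fun p => ?_) ((Equiv.addRight (n ∘ Sum.inl)).tsum_eq _)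
  have hv : castV p + (1 / 2 : ℂ) • fstV (m + (2 : ℤ) • n)
      = castV (p + n ∘ Sum.inl) + (1 / 2 : ℂ) • fstV m := by
    rw [hfst, castV_add]; simp only [fstV]; module
  have hexp : 2 * ((castV (p + n ∘ Sum.inl) + (1 / 2 : ℂ) • fstV m) ⬝ᵥ sndV n)
      = ((m ∘ Sum.inl) ⬝ᵥ (n ∘ Sum.inr) : ℤ)
        + 2 * ((p + n ∘ Sum.inl) ⬝ᵥ (n ∘ Sum.inr) : ℤ) := by
    rw [← dotProduct_castV, ← dotProduct_castV, add_dotProduct, smul_dotProduct, smul_eq_mul]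
    simp only [fstV, sndV]
    ring
  rw [hz, hv, thetaTerm_add_right, hexp, expPi_add_two_mul_int, mul_comm, Equiv.coe_addRight]

end ThetaSeries

section Convergence

open scoped MatrixOrder in
theorem exists_mul_sum_sq_le {ι : Type*} [Fintype ι] {Y : Matrix ι ι ℝ} (hY : Y.PosDef) :
    ∃ δ : ℝ, 0 < δ ∧ ∀ x : ι → ℝ, δ * ∑ i, x i ^ 2 ≤ x ⬝ᵥ Y *ᵥ x := by
  classical
  cases isEmpty_or_nonempty ι
  · exact ⟨1, one_pos, fun x => by simp [dotProduct]⟩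
  obtain ⟨δ, hδ, hle⟩ := (CFC.exists_pos_algebraMap_le_iff hY.1.isSelfAdjoint).2 fun x hx =>
    hY.isStrictlyPositive.spectrum_pos hx
  refine ⟨δ, hδ, fun x => ?_⟩
  have h := (Matrix.le_iff.1 hle).dotProduct_mulVec_nonneg x
  rw [Algebra.algebraMap_eq_smul_one, sub_mulVec, smul_mulVec, one_mulVec, dotProduct_sub,
    dotProduct_smul, sub_nonneg] at h
  simpa [dotProduct, sq] using h

theorem summable_prod_apply {α : Type*} {n : ℕ} {f : Fin n → α → ℝ} (hf : ∀ i, Summable (f i))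
    (h0 : ∀ i a, 0 ≤ f i a) : Summable fun p : Fin n → α => ∏ i, f i (p i) := by
  induction n with
  | zero => exact .of_finite
  | succ n ih =>
    rw [← (Fin.consEquiv fun _ : Fin (n + 1) => α).summable_iff]
    refine ((hf 0).mul_of_nonneg (ih (fun i => hf i.succ) fun i => h0 i.succ) (h0 0) fun p =>
      Finset.prod_nonneg fun i _ => h0 _ _).congr ?_
    rintro ⟨a, p⟩
    simp [Fin.prod_univ_succ, Fin.consEquiv]

theorem summable_thetaTerm {τ : Matrix (Fin g) (Fin g) ℂ} (hτ : τ ∈ SiegelUpperHalf g)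
    (z : Fin g → ℂ) : Summable fun p : Fin g → ℤ => thetaTerm τ z (castV p) := by
  obtain ⟨δ, hδ, hle⟩ := exists_mul_sum_sq_le hτ.2
  have hsum (i : Fin g) : Summable fun k => ‖jacobiTheta₂_term k (z i) (δ * Complex.I)‖ :=
    ((summable_jacobiTheta₂_term_iff _ _).2 (by simpa using hδ)).norm
  refine .of_norm_bounded (summable_prod_apply hsum fun _ _ => norm_nonneg _) fun p => ?_
  have hcast : castV p = fun i => ((p i : ℝ) : ℂ) := by ext i; simp [castV]
  have hz : (2 * (castV p ⬝ᵥ z)).im = ∑ i, 2 * (p i * (z i).im) := by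
    simp [castV, dotProduct, Finset.mul_sum]
  have hI : (δ * Complex.I).im = δ := by simp
  simp only [norm_jacobiTheta₂_term, ← Real.exp_sum, thetaTerm, norm_expPi, Real.exp_le_exp]
  calc -Real.pi * (castV p ⬝ᵥ τ *ᵥ castV p + 2 * (castV p ⬝ᵥ z)).im
      ≤ -Real.pi * (δ * ∑ i, (p i : ℝ) ^ 2 + ∑ i, 2 * (p i * (z i).im)) := by
        rw [Complex.add_im, hz, hcast, im_dotProduct_mulVec_ofReal, neg_mul, neg_mul,
          neg_le_neg_iff]
        have := hle fun i => p i
        gcongr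
    _ = ∑ i, (-Real.pi * p i ^ 2 * (δ * Complex.I).im - 2 * Real.pi * p i * (z i).im) := by
        rw [hI, Finset.mul_sum, ← Finset.sum_add_distrib, Finset.mul_sum]
        exact Finset.sum_congr rfl fun i _ => by ring

end Convergence

/-! ### The transformation formula -/

section Transform

/-- `(cτ + d)⁻¹ c`. -/
def autQuot (M : Sp g) (τ : Matrix (Fin g) (Fin g) ℂ) : Matrix (Fin g) (Fin g) ℂ :=
  (autFactor M τ)⁻¹ * toC (blkC M)

/-- The exponential factor `e(½ ᵗz (cτ + d)⁻¹ c z)`. -/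
def expFactor (M : Sp g) (τ : Matrix (Fin g) (Fin g) ℂ) (z : Fin g → ℂ) : ℂ :=
  e (1 / 2 * (z ⬝ᵥ autQuot M τ *ᵥ z))

theorem expFactor_eq_expPi (M : Sp g) (τ : Matrix (Fin g) (Fin g) ℂ) (z : Fin g → ℂ) :
    expFactor M τ z = expPi (z ⬝ᵥ autQuot M τ *ᵥ z) := by
  rw [expFactor, e_eq_expPi, ← mul_assoc, mul_one_div_cancel two_ne_zero, one_mul]

theorem expFactor_one (τ : Matrix (Fin g) (Fin g) ℂ) (z : Fin g → ℂ) : expFactor 1 τ z = 1 := by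
  simp [expFactor, autQuot, e, blk_one, toC_zero]

theorem expFactor_zero (M : Sp g) (τ : Matrix (Fin g) (Fin g) ℂ) : expFactor M τ 0 = 1 := by
  simp [expFactor, e]

theorem toC_blkC_mul_blkD_transpose (M : Sp g) :
    toC (blkC M) * (toC (blkD M))ᵀ = toC (blkD M) * (toC (blkC M))ᵀ := by
  have h : M.1 * (M⁻¹).1 = 1 := congrArg Subtype.val (mul_inv_cancel M)
  rw [coe_inv_eq_fromBlocks, coe_eq_fromBlocks M, fromBlocks_multiply, ← fromBlocks_one,
    fromBlocks_inj] at h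
  have hcd : blkC M * (blkD M)ᵀ = blkD M * (blkC M)ᵀ := by
    simpa only [mul_neg, ← sub_eq_add_neg, sub_eq_zero] using h.2.2.1
  rw [← toC_transpose, ← toC_transpose, ← toC_mul, ← toC_mul, hcd]

variable {τ : Matrix (Fin g) (Fin g) ℂ}

theorem autQuot_mul_autFactor_transpose (M : Sp g) (hτ : τ ∈ SiegelUpperHalf g) :
    autQuot M τ * (autFactor M τ)ᵀ = (toC (blkC M))ᵀ := by
  have h : toC (blkC M) * (autFactor M τ)ᵀ = autFactor M τ * (toC (blkC M))ᵀ := by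
    simp only [autFactor, transpose_add, transpose_mul, hτ.1, mul_add, add_mul,
      toC_blkC_mul_blkD_transpose, mul_assoc]
  rw [autQuot, mul_assoc, h, nonsing_inv_mul_cancel_left _ _ (isUnit_det_autFactor M hτ)]

theorem autQuot_transpose (M : Sp g) (hτ : τ ∈ SiegelUpperHalf g) :
    (autQuot M τ)ᵀ = autQuot M τ := by
  have hut : IsUnit (autFactor M τ)ᵀ.det := by
    rw [det_transpose]; exact isUnit_det_autFactor M hτ
  rw [autQuot, transpose_mul, ← autQuot_mul_autFactor_transpose M hτ, transpose_nonsing_inv,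
    mul_nonsing_inv_cancel_right _ _ hut, autQuot]

theorem autQuot_mul (M N : Sp g) (hτ : τ ∈ SiegelUpperHalf g) :
    autQuot (M * N) τ =
      (autFactor N τ)⁻¹ * autQuot M (act N τ) * ((autFactor N τ)⁻¹)ᵀ + autQuot N τ := by
  have h : toC (blkC (M * N)) = toC (blkC M) * ((autFactor N τ)⁻¹)ᵀ
      + autFactor M (act N τ) * toC (blkC N) := by
    rw [autFactor_inv_transpose N hτ, (blk_mul M N).2.2.1, autFactor]
    simp only [toC_add, toC_mul]
    noncomm_ring
  rw [autQuot, autFactor_mul M N hτ, h, Matrix.mul_inv_rev, mul_add, mul_assoc, mul_assoc,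
    nonsing_inv_mul_cancel_left _ _ (isUnit_det_autFactor M (act_mem N hτ))]
  simp only [autQuot, mul_assoc]

theorem expFactor_mul (M N : Sp g) (hτ : τ ∈ SiegelUpperHalf g) (z : Fin g → ℂ) :
    expFactor (M * N) τ z =
      expFactor M (act N τ) (((autFactor N τ)⁻¹)ᵀ *ᵥ z) * expFactor N τ z := by
  simp only [expFactor_eq_expPi, ← expPi_add, autQuot_mul M N hτ, add_mulVec, dotProduct_add]
  rw [mul_assoc, ← mulVec_mulVec, ← mulVec_mulVec, dotProduct_mulVec z, ← mulVec_transpose]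

theorem fstV_transpose_mulVec (M : Sp g) (m : Characteristic g) :
    fstV (M.1ᵀ *ᵥ m) = (toC (blkA M))ᵀ *ᵥ fstV m + (toC (blkC M))ᵀ *ᵥ sndV m := by
  rw [fstV, fstV, sndV, ← toC_transpose, ← toC_transpose, toC_mulVec_castV, toC_mulVec_castV,
    ← castV_add, coe_eq_fromBlocks M, fromBlocks_transpose, fromBlocks_mulVec]
  rfl

theorem sndV_transpose_mulVec (M : Sp g) (m : Characteristic g) :
    sndV (M.1ᵀ *ᵥ m) = (toC (blkB M))ᵀ *ᵥ fstV m + (toC (blkD M))ᵀ *ᵥ sndV m := by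
  rw [sndV, fstV, sndV, ← toC_transpose, ← toC_transpose, toC_mulVec_castV, toC_mulVec_castV,
    ← castV_add, coe_eq_fromBlocks M, fromBlocks_transpose, fromBlocks_mulVec]
  rfl

theorem autFactor_transpose_mulVec_periodVec (M : Sp g) (hτ : τ ∈ SiegelUpperHalf g)
    (m : Characteristic g) :
    (autFactor M τ)ᵀ *ᵥ periodVec (act M τ) m = periodVec τ (M.1ᵀ *ᵥ m) := by
  have h : (autFactor M τ)ᵀ * act M τ = (actNum M τ)ᵀ := by
    rw [← act_mul_autFactor M hτ, transpose_mul, act_transpose M hτ]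
  rw [periodVec, periodVec, mulVec_add, mulVec_mulVec, h, fstV_transpose_mulVec,
    sndV_transpose_mulVec]
  simp only [actNum, autFactor, transpose_add, transpose_mul, hτ.1, mulVec_add, add_mulVec,
    mulVec_mulVec]
  abel

theorem autFactor_inv_transpose_mulVec_periodVec (M : Sp g) (hτ : τ ∈ SiegelUpperHalf g)
    (m : Characteristic g) :
    ((autFactor M τ)⁻¹)ᵀ *ᵥ periodVec τ (M.1ᵀ *ᵥ m) = periodVec (act M τ) m := by
  rw [← autFactor_transpose_mulVec_periodVec M hτ, mulVec_mulVec, ← transpose_mul,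
    mul_nonsing_inv _ (isUnit_det_autFactor M hτ), transpose_one, one_mulVec]

theorem autQuot_mulVec_periodVec (M : Sp g) (hτ : τ ∈ SiegelUpperHalf g)
    (m : Characteristic g) :
    autQuot M τ *ᵥ periodVec τ (M.1ᵀ *ᵥ m)
      = fstV (M.1ᵀ *ᵥ m) - (autFactor M τ)⁻¹ *ᵥ fstV m := by
  have hinv : (autFactor M τ)⁻¹ = (toC (blkA M))ᵀ - (toC (blkC M))ᵀ * act M τ := by
    rw [← transpose_transpose (autFactor M τ)⁻¹, autFactor_inv_transpose M hτ, transpose_sub,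
      transpose_mul, act_transpose M hτ]
  rw [← autFactor_transpose_mulVec_periodVec M hτ, mulVec_mulVec,
    autQuot_mul_autFactor_transpose M hτ, hinv, fstV_transpose_mulVec, periodVec, mulVec_add,
    sub_mulVec, mulVec_mulVec]
  abel

/-- `κ` is the factor of automorphy of the theta function of characteristic zero under `M`, a square
root of `det(cτ + d)` up to a root of unity. -/
structure IsThetaFactor (M : Sp g) (κ : Matrix (Fin g) (Fin g) ℂ → ℂ) : Prop where
  continuousOn : ContinuousOn κ (SiegelUpperHalf g)
  sq_eq : ∃ ζ : ℂ, ζ ^ 4 = 1 ∧ ∀ τ ∈ SiegelUpperHalf g, κ τ ^ 2 = ζ * (autFactor M τ).det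
  transform : ∀ τ ∈ SiegelUpperHalf g, ∀ z, thetaZero (act M τ) (((autFactor M τ)⁻¹)ᵀ *ᵥ z)
    = κ τ * expFactor M τ z * thetaZero τ z

namespace IsThetaFactor

variable {M N : Sp g} {κ μ : Matrix (Fin g) (Fin g) ℂ → ℂ}

theorem ne_zero (h : IsThetaFactor M κ) (hτ : τ ∈ SiegelUpperHalf g) : κ τ ≠ 0 := by
  obtain ⟨ζ, hζ, hsq⟩ := h.sq_eq
  have hζ0 : ζ ≠ 0 := (IsUnit.of_pow_eq_one hζ four_ne_zero).ne_zero
  refine (pow_ne_zero_iff two_ne_zero).1 ?_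
  rw [hsq τ hτ]
  exact mul_ne_zero hζ0 (isUnit_det_autFactor M hτ).ne_zero

theorem one : IsThetaFactor (1 : Sp g) fun _ => 1 where
  continuousOn := continuousOn_const
  sq_eq := ⟨1, one_pow 4, fun τ _ => by simp [autFactor_one]⟩
  transform τ _ z := by simp [act_one, autFactor_one, expFactor_one]

theorem mul (hM : IsThetaFactor M κ) (hN : IsThetaFactor N μ) :
    IsThetaFactor (M * N) fun τ => κ (act N τ) * μ τ where
  continuousOn := (hM.continuousOn.comp (continuousOn_act N) fun _ h => act_mem N h).mul
    hN.continuousOn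
  sq_eq := by
    obtain ⟨ζ, hζ, hκ⟩ := hM.sq_eq
    obtain ⟨ξ, hξ, hμ⟩ := hN.sq_eq
    refine ⟨ζ * ξ, by rw [mul_pow, hζ, hξ, one_mul], fun τ hτ => ?_⟩
    rw [mul_pow, hκ _ (act_mem N hτ), hμ τ hτ, autFactor_mul M N hτ, det_mul]
    ring
  transform τ hτ z := by
    rw [act_mul M N hτ, autFactor_mul M N hτ, Matrix.mul_inv_rev, transpose_mul, ← mulVec_mulVec,
      hM.transform _ (act_mem N hτ), hN.transform τ hτ, expFactor_mul M N hτ]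
    ring

theorem inv (hM : IsThetaFactor M κ) : IsThetaFactor M⁻¹ fun τ => (κ (act M⁻¹ τ))⁻¹ where
  continuousOn := (hM.continuousOn.comp (continuousOn_act M⁻¹) fun _ h => act_mem M⁻¹ h).inv₀
    fun τ hτ => hM.ne_zero (act_mem M⁻¹ hτ)
  sq_eq := by
    obtain ⟨ζ, hζ, hκ⟩ := hM.sq_eq
    refine ⟨ζ⁻¹, by rw [inv_pow, hζ, inv_one], fun τ hτ => ?_⟩
    have hdet : (autFactor M (act M⁻¹ τ)).det * (autFactor M⁻¹ τ).det = 1 := by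
      rw [← det_mul, ← autFactor_mul M M⁻¹ hτ, mul_inv_cancel, autFactor_one, det_one]
    rw [inv_pow, hκ _ (act_mem M⁻¹ hτ), _root_.mul_inv, inv_eq_of_mul_eq_one_right hdet]
  transform τ hτ z := by
    have hact : act M (act M⁻¹ τ) = τ := by rw [← act_mul M M⁻¹ hτ, mul_inv_cancel, act_one]
    have hfactor : (autFactor M (act M⁻¹ τ))⁻¹ = autFactor M⁻¹ τ := by
      refine inv_eq_right_inv ?_
      rw [← autFactor_mul M M⁻¹ hτ, mul_inv_cancel, autFactor_one]
    set w := ((autFactor M⁻¹ τ)⁻¹)ᵀ *ᵥ z with hw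
    have htheta : thetaZero τ z = κ (act M⁻¹ τ) * expFactor M (act M⁻¹ τ) w
        * thetaZero (act M⁻¹ τ) w := by
      rw [← hM.transform _ (act_mem M⁻¹ hτ), hact, hfactor, hw, mulVec_mulVec, ← transpose_mul,
        nonsing_inv_mul _ (isUnit_det_autFactor M⁻¹ hτ), transpose_one, one_mulVec]
    have hexp : expFactor M (act M⁻¹ τ) w * expFactor M⁻¹ τ z = 1 := by
      rw [← expFactor_mul M M⁻¹ hτ, mul_inv_cancel, expFactor_one]
    have hκ := hM.ne_zero (act_mem M⁻¹ hτ)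
    rw [htheta]
    field_simp
    linear_combination -thetaZero (act M⁻¹ τ) w * hexp

theorem theta (hM : IsThetaFactor M κ) (m : Characteristic g) (hτ : τ ∈ SiegelUpperHalf g)
    (z : Fin g → ℂ) :
    SiegelTheta.theta m (act M τ) (((autFactor M τ)⁻¹)ᵀ *ᵥ z) =
      κ τ * expFactor M τ z * expPi (1 / 4 * (quad m - quad (M.1ᵀ *ᵥ m)))
        * SiegelTheta.theta (M.1ᵀ *ᵥ m) τ z := by
  have hperiod := autFactor_inv_transpose_mulVec_periodVec M hτ m
  have hquot := autQuot_mulVec_periodVec M hτ m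
  set n := M.1ᵀ *ᵥ m
  set D := autFactor M τ
  set x := periodVec τ n with hx
  have hshift : (D⁻¹)ᵀ *ᵥ z + (1 / 2 : ℂ) • periodVec (act M τ) m
      = (D⁻¹)ᵀ *ᵥ (z + (1 / 2 : ℂ) • x) := by
    rw [mulVec_add, mulVec_smul, hperiod]
  have hmz : fstV m ⬝ᵥ (D⁻¹)ᵀ *ᵥ z = z ⬝ᵥ D⁻¹ *ᵥ fstV m := by
    rw [mulVec_transpose, dotProduct_comm, ← dotProduct_mulVec]
  have hxm : x ⬝ᵥ D⁻¹ *ᵥ fstV m = fstV m ⬝ᵥ act M τ *ᵥ fstV m + quad m := by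
    rw [dotProduct_mulVec, ← mulVec_transpose, hperiod, dotProduct_comm, periodVec,
      dotProduct_add, fstV_dotProduct_sndV]
  have hxn : x ⬝ᵥ fstV n = fstV n ⬝ᵥ τ *ᵥ fstV n + quad n := by
    rw [dotProduct_comm, hx, periodVec, dotProduct_add, fstV_dotProduct_sndV]
  have hexp : thetaTerm (act M τ) ((D⁻¹)ᵀ *ᵥ z + (1 / 2 : ℂ) • sndV m) ((1 / 2 : ℂ) • fstV m)
        * expFactor M τ (z + (1 / 2 : ℂ) • x)
      = expFactor M τ z * expPi (1 / 4 * (quad m - quad n))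
        * thetaTerm τ (z + (1 / 2 : ℂ) • sndV n) ((1 / 2 : ℂ) • fstV n) := by
    simp only [thetaTerm, expFactor_eq_expPi, ← expPi_add, mulVec_add, mulVec_smul, add_dotProduct,
      dotProduct_add, smul_dotProduct, dotProduct_smul, smul_eq_mul,
      dotProduct_mulVec_comm (autQuot_transpose M hτ) x z, hquot, dotProduct_sub, hmz, hxm, hxn,
      fstV_dotProduct_sndV, dotProduct_comm z (fstV n)]
    congr 1
    ring
  rw [theta_eq_thetaZero m (act_transpose M hτ), theta_eq_thetaZero n hτ.1, hshift,
    hM.transform τ hτ]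
  linear_combination κ τ * thetaZero τ (z + (1 / 2 : ℂ) • x) * hexp

end IsThetaFactor

/-- The group of those `M` under which the theta function of characteristic zero is a modular
form. -/
def thetaGroup (g : ℕ) : Subgroup (Sp g) where
  carrier := {M | ∃ κ, IsThetaFactor M κ}
  one_mem' := ⟨_, .one⟩
  mul_mem' := fun ⟨_, hκ⟩ ⟨_, hμ⟩ => ⟨_, hκ.mul hμ⟩
  inv_mem' := fun ⟨_, hκ⟩ => ⟨_, hκ.inv⟩

end Transform

/-! ### The generators in the theta group -/

section BlockTriangular

theorem det_toC_sq_eq_one {X Y : Matrix (Fin g) (Fin g) ℤ} (h : X * Y = 1) :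
    (toC X).det ^ 2 = 1 := by
  have hdet : (toC X).det = (X.det : ℂ) := (RingHom.map_det (Int.castRingHom ℂ) X).symm
  have hunit : IsUnit X.det := .of_mul_eq_one Y.det (by rw [← det_mul, h, det_one])
  rw [hdet, ← Int.cast_pow, Int.isUnit_sq hunit, Int.cast_one]

theorem mem_thetaGroup_of_blkC_eq_zero {M : Sp g} (hc : blkC M = 0)
    (heven : ∀ p, Even (p ⬝ᵥ (blkB M * (blkA M)ᵀ) *ᵥ p)) : M ∈ thetaGroup g := by
  obtain ⟨-, -, -, had⟩ := blk_relations M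
  rw [hc, transpose_zero, zero_mul, sub_zero] at had
  have hda : blkD M * (blkA M)ᵀ = 1 := mul_eq_one_comm.1 had
  have hfactor (τ) : autFactor M τ = toC (blkD M) := by
    rw [autFactor, hc, toC_zero, zero_mul, zero_add]
  have hinv : (toC (blkD M))⁻¹ = toC (blkA M)ᵀ :=
    inv_eq_left_inv (by rw [← toC_mul, had, toC_one])
  have hdet := det_toC_sq_eq_one hda
  refine ⟨fun _ => 1, continuousOn_const, ⟨(toC (blkD M)).det, ?_, fun τ _ => ?_⟩, fun τ _ z => ?_⟩
  · rw [show 4 = 2 * 2 from rfl, pow_mul, hdet, one_pow]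
  · rw [hfactor, one_pow, ← sq, hdet]
  have hexp : expFactor M τ z = 1 := by simp [expFactor, autQuot, hc, toC_zero, e]
  have hact : act M τ
      = toC (blkA M) * τ * toC (blkA M)ᵀ + toC (blkB M * (blkA M)ᵀ) := by
    rw [act, hfactor, hinv, add_mul, toC_mul]
  let E : (Fin g → ℤ) ≃ (Fin g → ℤ) :=
    { toFun := fun p => (blkA M)ᵀ *ᵥ p
      invFun := fun p => blkD M *ᵥ p
      left_inv := fun p => (mulVec_mulVec ..).trans (by rw [hda, one_mulVec])
      right_inv := fun p => (mulVec_mulVec ..).trans (by rw [had, one_mulVec]) }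
  rw [hexp, one_mul, one_mul, thetaZero, thetaZero, ← E.tsum_eq fun p => thetaTerm τ z (castV p)]
  refine tsum_congr fun p => ?_
  obtain ⟨k, hk⟩ := heven p
  have hE : castV (E p) = toC (blkA M)ᵀ *ᵥ castV p := (toC_mulVec_castV _ _).symm
  have hAv (v : Fin g → ℂ) : castV p ⬝ᵥ toC (blkA M) *ᵥ v = castV (E p) ⬝ᵥ v := by
    rw [hE, dotProduct_mulVec, toC_transpose, mulVec_transpose]
  have hBA : castV p ⬝ᵥ toC (blkB M * (blkA M)ᵀ) *ᵥ castV p = 2 * (k : ℂ) := by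
    rw [toC_mulVec_castV, dotProduct_castV, hk, Int.cast_add, two_mul]
  rw [thetaTerm, thetaTerm, hfactor, hinv, hact, toC_transpose, transpose_transpose, hAv,
    add_mulVec, dotProduct_add, hBA, ← mulVec_mulVec, ← mulVec_mulVec, hAv, ← toC_transpose, ← hE,
    add_right_comm, expPi_add_two_mul_int]

theorem A_mem_thetaGroup (i j : Fin g) : A i j ∈ thetaGroup g := by
  have hb : blkB (A i j) = 0 := toBlocks_fromBlocks₁₂ ..
  exact mem_thetaGroup_of_blkC_eq_zero (toBlocks_fromBlocks₂₁ ..) fun p => by simp [hb]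

theorem B_mem_thetaGroup (i j : Fin g) : B i j ∈ thetaGroup g := by
  have ha : blkA (B i j) = 1 := toBlocks_fromBlocks₁₁ ..
  have hb : blkB (B i j) = genB i j := toBlocks_fromBlocks₁₂ ..
  refine mem_thetaGroup_of_blkC_eq_zero (toBlocks_fromBlocks₂₁ ..) fun p => ?_
  rw [ha, hb, transpose_one, mul_one]
  have hrow (k : Fin g) : Even ((genB i j *ᵥ p) k) := by
    change Even (∑ l, genB i j k l * p l)
    refine Finset.even_sum _ fun l _ => Even.mul_right ?_ _
    simp only [genB, of_apply]
    split_ifs <;> decide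
  exact Finset.even_sum _ fun k _ => (hrow k).mul_left _

end BlockTriangular

section PartialInversion

/-- The inversion `τ_{ii} ↦ -1/τ_{ii}` in the `i`-th coordinate, as an element of `Sp(g, ℤ)`. -/
def partialInv (i : Fin g) : Sp g :=
  ⟨fromBlocks (1 - single i i 1) (-single i i 1) (single i i 1) (1 - single i i 1), by
    rw [SymplecticGroup.mem_iff, J, fromBlocks_multiply, fromBlocks_transpose, fromBlocks_multiply]
    simp [mul_sub, sub_mul]
    abel⟩

theorem C_self_mul_partialInv_mul_B_self (i : Fin g) :
    C i i * partialInv i * B i i = partialInv i := by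
  apply Subtype.ext
  simp only [Submonoid.coe_mul, C, B, partialInv, genB_self, fromBlocks_transpose,
    fromBlocks_multiply]
  simp [mul_sub, sub_mul]

theorem C_mul_partialInv {i j : Fin g} (h : i ≠ j) :
    C i j * partialInv i = partialInv i * A i j := by
  apply Subtype.ext
  simp only [Submonoid.coe_mul, A, C, B, partialInv]
  rw [inv_genA_of_ne h, genA_of_ne h, genB_of_ne h, fromBlocks_transpose, fromBlocks_multiply,
    fromBlocks_multiply]
  simp [mul_sub, mul_add, sub_mul, add_mul, h, h.symm]
  constructor <;> abel

theorem toC_single (i j : Fin g) : toC (single i j 1) = single i j 1 := by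
  ext k l; simp [toC, single_apply]

theorem autFactor_partialInv_mulVec (i : Fin g) (τ : Matrix (Fin g) (Fin g) ℂ) (v : Fin g → ℂ) :
    autFactor (partialInv i) τ *ᵥ v = Function.update v i ((τ *ᵥ v) i) := by
  have hc : blkC (partialInv i) = single i i 1 := toBlocks_fromBlocks₂₁ ..
  have hd : blkD (partialInv i) = 1 - single i i 1 := toBlocks_fromBlocks₂₂ ..
  rw [autFactor, hc, hd, toC_sub, toC_one, toC_single, add_mulVec, sub_mulVec, one_mulVec,
    ← mulVec_mulVec]
  ext k
  by_cases hk : k = i <;> simp [hk, single_mulVec, -mulVec_mulVec]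

theorem actNum_partialInv_mulVec (i : Fin g) (τ : Matrix (Fin g) (Fin g) ℂ) (v : Fin g → ℂ) :
    actNum (partialInv i) τ *ᵥ v = Function.update (τ *ᵥ v) i (-v i) := by
  have ha : blkA (partialInv i) = 1 - single i i 1 := toBlocks_fromBlocks₁₁ ..
  have hb : blkB (partialInv i) = -single i i 1 := toBlocks_fromBlocks₁₂ ..
  rw [actNum, ha, hb, ← zero_sub (single i i 1), toC_sub, toC_sub, toC_one, toC_zero, toC_single,
    add_mulVec, sub_mulVec, zero_mulVec, ← mulVec_mulVec, sub_mulVec, one_mulVec]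
  ext k
  by_cases hk : k = i <;> simp [hk, single_mulVec, -mulVec_mulVec]

theorem det_autFactor_partialInv (i : Fin g) (τ : Matrix (Fin g) (Fin g) ℂ) :
    (autFactor (partialInv i) τ).det = τ i i := by
  have h : autFactor (partialInv i) τ = updateRow 1 i (τ i) := by
    refine ext_of_mulVec_single fun j => ?_
    rw [autFactor_partialInv_mulVec]
    ext k
    by_cases hk : k = i <;> simp [hk, one_apply, Pi.single_apply]
  rw [h, ← cramer_transpose_apply, transpose_one, cramer_one]
  rfl

variable {τ : Matrix (Fin g) (Fin g) ℂ}

theorem im_diag_pos (hτ : τ ∈ SiegelUpperHalf g) (i : Fin g) : 0 < (τ i i).im := by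
  simpa using hτ.2.diag_pos (i := i)

theorem diag_ne_zero (hτ : τ ∈ SiegelUpperHalf g) (i : Fin g) : τ i i ≠ 0 := fun h => by
  simpa [h] using im_diag_pos hτ i

theorem autFactor_partialInv_inv_mulVec (hτ : τ ∈ SiegelUpperHalf g) (i : Fin g)
    (v : Fin g → ℂ) :
    (autFactor (partialInv i) τ)⁻¹ *ᵥ v
      = v + ((v i - (τ *ᵥ v) i) / τ i i) • Pi.single i 1 := by
  have ht := diag_ne_zero hτ i
  have h : autFactor (partialInv i) τ
      *ᵥ (v + ((v i - (τ *ᵥ v) i) / τ i i) • Pi.single i 1) = v := by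
    rw [autFactor_partialInv_mulVec]
    ext k
    by_cases hk : k = i
    · simp [hk, mulVec_add, mulVec_smul, ht]
    · simp [hk]
  nth_rw 1 [← h]
  rw [mulVec_mulVec, nonsing_inv_mul _ (isUnit_det_autFactor _ hτ), one_mulVec]

theorem autFactor_partialInv_inv_mulVec_single (hτ : τ ∈ SiegelUpperHalf g) (i : Fin g) :
    (autFactor (partialInv i) τ)⁻¹ *ᵥ Pi.single i 1 = (τ i i)⁻¹ • Pi.single i 1 := by
  have ht := diag_ne_zero hτ i
  rw [autFactor_partialInv_inv_mulVec hτ]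
  ext k
  by_cases hk : k = i
  · simp [hk]; field_simp; ring
  · simp [hk]

theorem act_partialInv_mulVec_apply_self (τ : Matrix (Fin g) (Fin g) ℂ) (i : Fin g)
    (v : Fin g → ℂ) :
    (act (partialInv i) τ *ᵥ v) i = -((autFactor (partialInv i) τ)⁻¹ *ᵥ v) i := by
  rw [act_eq, ← mulVec_mulVec, actNum_partialInv_mulVec, Function.update_self]

theorem act_partialInv_apply_self (hτ : τ ∈ SiegelUpperHalf g) (i : Fin g) :
    act (partialInv i) τ i i = -1 / τ i i := by
  have h := act_partialInv_mulVec_apply_self τ i (Pi.single i 1)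
  rw [autFactor_partialInv_inv_mulVec_single hτ] at h
  simpa [neg_div] using h

theorem dotProduct_act_partialInv_mulVec (hτ : τ ∈ SiegelUpperHalf g) {i : Fin g}
    {v : Fin g → ℂ} (hv : v i = 0) :
    v ⬝ᵥ act (partialInv i) τ *ᵥ v = v ⬝ᵥ τ *ᵥ v - (τ *ᵥ v) i ^ 2 / τ i i := by
  have hcol : v ⬝ᵥ τ *ᵥ Pi.single i 1 = (τ *ᵥ v) i := by
    rw [dotProduct_mulVec_comm hτ.1, single_dotProduct, one_mul]
  have hupdate (u : Fin g → ℂ) (c : ℂ) : v ⬝ᵥ Function.update u i c = v ⬝ᵥ u := by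
    refine Finset.sum_congr rfl fun k _ => ?_
    by_cases hk : k = i <;> simp [hk, hv]
  rw [act_eq, ← mulVec_mulVec, actNum_partialInv_mulVec, hupdate,
    autFactor_partialInv_inv_mulVec hτ, mulVec_add, mulVec_smul, dotProduct_add, dotProduct_smul,
    hcol, hv, smul_eq_mul]
  ring

theorem dotProduct_autQuot_partialInv_mulVec (hτ : τ ∈ SiegelUpperHalf g) (i : Fin g)
    (z : Fin g → ℂ) : z ⬝ᵥ autQuot (partialInv i) τ *ᵥ z = z i ^ 2 / τ i i := by
  have hc : blkC (partialInv i) = single i i 1 := toBlocks_fromBlocks₂₁ ..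
  have hz : single i i (1 : ℂ) *ᵥ z = z i • Pi.single i 1 := by
    ext k
    by_cases hk : k = i <;> simp [hk, single_mulVec, -mulVec_mulVec]
  rw [autQuot, hc, toC_single, ← mulVec_mulVec, hz, mulVec_smul,
    autFactor_partialInv_inv_mulVec_single hτ, dotProduct_smul, dotProduct_smul,
    dotProduct_single, smul_eq_mul, smul_eq_mul]
  ring

/-- Extension by zero at the coordinate `i`. -/
def extendZero (i : Fin g) (q : {j : Fin g // j ≠ i} → ℤ) : Fin g → ℤ :=
  (Equiv.funSplitAt i ℤ).symm (0, q)

theorem castV_extendZero_self (i : Fin g) (q : {j : Fin g // j ≠ i} → ℤ) :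
    castV (extendZero i q) i = 0 := by
  simp [castV, extendZero, Equiv.funSplitAt, Equiv.piSplitAt]

theorem castV_funSplitAt_symm (i : Fin g) (k : ℤ) (q : {j : Fin g // j ≠ i} → ℤ) :
    castV ((Equiv.funSplitAt i ℤ).symm (k, q)) = Pi.single i (k : ℂ) + castV (extendZero i q) := by
  ext l
  by_cases h : l = i
  · subst h
    simp [castV, extendZero, Equiv.funSplitAt, Equiv.piSplitAt]
  · simp [castV, extendZero, Equiv.funSplitAt, Equiv.piSplitAt, h]

theorem thetaTerm_single (τ : Matrix (Fin g) (Fin g) ℂ) (z : Fin g → ℂ) (i : Fin g) (k : ℤ) :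
    thetaTerm τ z (Pi.single i (k : ℂ)) = jacobiTheta₂_term k (z i) (τ i i) := by
  rw [thetaTerm, expPi, jacobiTheta₂_term, single_dotProduct, single_dotProduct]
  congr 1
  simp only [mulVec_single, Pi.smul_apply, col_apply, op_smul_eq_smul, smul_eq_mul]
  ring

theorem thetaZero_eq_tsum_jacobiTheta₂ (hτ : τ ∈ SiegelUpperHalf g) (z : Fin g → ℂ) (i : Fin g) :
    thetaZero τ z = ∑' q : {j : Fin g // j ≠ i} → ℤ, thetaTerm τ z (castV (extendZero i q))
      * jacobiTheta₂ (z i + (τ *ᵥ castV (extendZero i q)) i) (τ i i) := by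
  let E : ({j : Fin g // j ≠ i} → ℤ) × ℤ ≃ (Fin g → ℤ) :=
    (Equiv.prodComm _ _).trans (Equiv.funSplitAt i ℤ).symm
  have hsum : Summable fun x => thetaTerm τ z (castV (E x)) :=
    E.summable_iff.2 (summable_thetaTerm hτ z)
  rw [thetaZero, ← E.tsum_eq, hsum.tsum_prod]
  refine tsum_congr fun q => ?_
  rw [jacobiTheta₂, ← tsum_mul_left]
  refine tsum_congr fun k => ?_
  change thetaTerm τ z (castV ((Equiv.funSplitAt i ℤ).symm (k, q))) = _
  rw [castV_funSplitAt_symm, thetaTerm_add hτ.1, thetaTerm_single, Pi.add_apply]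

theorem jacobiTheta₂_neg_one_div {t : ℂ} (ht : t ≠ 0) (w : ℂ) :
    jacobiTheta₂ (w / t) (-1 / t)
      = (-Complex.I * t) ^ (1 / 2 : ℂ) * expPi (w ^ 2 / t) * jacobiTheta₂ w t := by
  have hpow : (-Complex.I * t) ^ (1 / 2 : ℂ) ≠ 0 := by simp [Complex.cpow_eq_zero_iff, ht]
  have hexp : expPi (w ^ 2 / t) * Complex.exp (-Real.pi * Complex.I * w ^ 2 / t) = 1 := by
    rw [expPi, ← Complex.exp_add, ← Complex.exp_zero]
    congr 1
    ring
  rw [jacobiTheta₂_functional_equation w t]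
  calc jacobiTheta₂ (w / t) (-1 / t)
      = expPi (w ^ 2 / t) * Complex.exp (-Real.pi * Complex.I * w ^ 2 / t)
        * jacobiTheta₂ (w / t) (-1 / t) := by rw [hexp, one_mul]
    _ = _ := by field_simp [hpow]

theorem thetaTerm_act_partialInv (hτ : τ ∈ SiegelUpperHalf g) {i : Fin g} (z : Fin g → ℂ)
    {v : Fin g → ℂ} (hv : v i = 0) :
    thetaTerm (act (partialInv i) τ) (((autFactor (partialInv i) τ)⁻¹)ᵀ *ᵥ z) v
        * expPi ((z i + (τ *ᵥ v) i) ^ 2 / τ i i)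
      = expFactor (partialInv i) τ z * thetaTerm τ z v := by
  have hz : v ⬝ᵥ ((autFactor (partialInv i) τ)⁻¹)ᵀ *ᵥ z
      = v ⬝ᵥ z - (τ *ᵥ v) i * z i / τ i i := by
    rw [mulVec_transpose, dotProduct_comm, ← dotProduct_mulVec, autFactor_partialInv_inv_mulVec hτ,
      dotProduct_add, dotProduct_smul, dotProduct_single, hv, smul_eq_mul, dotProduct_comm]
    ring
  rw [thetaTerm, thetaTerm, expFactor_eq_expPi, dotProduct_autQuot_partialInv_mulVec hτ,
    dotProduct_act_partialInv_mulVec hτ hv, hz, ← expPi_add, ← expPi_add]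
  congr 1
  ring

theorem transpose_mulVec_apply (X : Matrix (Fin g) (Fin g) ℂ) (z : Fin g → ℂ) (i : Fin g) :
    (Xᵀ *ᵥ z) i = z ⬝ᵥ X *ᵥ Pi.single i 1 := by
  rw [mulVec_single_one, dotProduct_comm]
  rfl

theorem isThetaFactor_partialInv (i : Fin g) :
    IsThetaFactor (partialInv i) fun τ => (-Complex.I * τ i i) ^ (1 / 2 : ℂ) where
  continuousOn τ hτ := by
    have hslit : -Complex.I * τ i i ∈ Complex.slitPlane := .inl (by simpa using im_diag_pos hτ i)
    have hentry : Continuous fun τ : Matrix (Fin g) (Fin g) ℂ => -Complex.I * τ i i := by fun_prop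
    exact (hentry.continuousAt.cpow continuousAt_const hslit).continuousWithinAt
  sq_eq := by
    refine ⟨-Complex.I, by norm_num [Complex.I_pow_four], fun τ _ => ?_⟩
    rw [← Complex.cpow_nat_mul, det_autFactor_partialInv]
    simp
  transform τ hτ z := by
    have hact := act_mem (partialInv i) hτ
    rw [thetaZero_eq_tsum_jacobiTheta₂ hact _ i, thetaZero_eq_tsum_jacobiTheta₂ hτ z i,
      ← tsum_mul_left]
    refine tsum_congr fun q => ?_
    have hv := castV_extendZero_self i q
    set v := castV (extendZero i q)
    have harg : (((autFactor (partialInv i) τ)⁻¹)ᵀ *ᵥ z) i + (act (partialInv i) τ *ᵥ v) i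
        = (z i + (τ *ᵥ v) i) / τ i i := by
      have hzi : (((autFactor (partialInv i) τ)⁻¹)ᵀ *ᵥ z) i = z i / τ i i := by
        rw [transpose_mulVec_apply, autFactor_partialInv_inv_mulVec_single hτ, dotProduct_smul,
          dotProduct_single_one, smul_eq_mul, div_eq_inv_mul]
      rw [hzi, act_partialInv_mulVec_apply_self τ, autFactor_partialInv_inv_mulVec hτ]
      simp [hv]
      ring
    rw [harg, act_partialInv_apply_self hτ, jacobiTheta₂_neg_one_div (diag_ne_zero hτ i)]
    linear_combination (-Complex.I * τ i i) ^ (1 / 2 : ℂ)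
      * jacobiTheta₂ (z i + (τ *ᵥ v) i) (τ i i) * thetaTerm_act_partialInv hτ z hv

theorem C_mem_thetaGroup (i j : Fin g) : C i j ∈ thetaGroup g := by
  have hJ : partialInv i ∈ thetaGroup g := ⟨_, isThetaFactor_partialInv i⟩
  by_cases h : i = j
  · subst h
    have hmem := C_self_mul_partialInv_mul_B_self i ▸ hJ
    rwa [Subgroup.mul_mem_cancel_right _ (B_mem_thetaGroup i i),
      Subgroup.mul_mem_cancel_right _ hJ] at hmem
  · rw [← Subgroup.mul_mem_cancel_right _ hJ, C_mul_partialInv h]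
    exact mul_mem hJ (A_mem_thetaGroup i j)

theorem Gamma2_le_thetaGroup : Gamma2 g ≤ thetaGroup g :=
  genGroup_eq_Gamma2 (g := g) ▸ genGroup_le A_mem_thetaGroup B_mem_thetaGroup C_mem_thetaGroup

end PartialInversion

/-! ### The values of `χ_m` -/

section Multiplier

variable {M : Sp g} {κ : Matrix (Fin g) (Fin g) ℂ → ℂ} {τ : Matrix (Fin g) (Fin g) ℂ}

theorem IsThetaFactor.theta_of_mem_Gamma2 (hκ : IsThetaFactor M κ) (hM : M ∈ Gamma2 g)
    (m : Characteristic g) (hτ : τ ∈ SiegelUpperHalf g) (z : Fin g → ℂ) :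
    SiegelTheta.theta m (act M τ) (((autFactor M τ)⁻¹)ᵀ *ᵥ z) =
      κ τ * expFactor M τ z * expPi (1 / 2 * chiExp m M) * SiegelTheta.theta m τ z := by
  have htheta : SiegelTheta.theta (M.1ᵀ *ᵥ m) τ z =
      expPi ((m ∘ Sum.inl) ⬝ᵥ (halfDiff M m ∘ Sum.inr) : ℤ) * SiegelTheta.theta m τ z := by
    rw [transpose_mulVec_eq hM, theta_add_two_smul]
  have hchi : (2 : ℂ) * chiExp m M = (quad m : ℂ) - quad (M.1ᵀ *ᵥ m)
      + 4 * ((m ∘ Sum.inl) ⬝ᵥ (halfDiff M m ∘ Sum.inr) : ℤ) := by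
    exact_mod_cast two_mul_chiExp hM m
  rw [hκ.theta m hτ z, htheta, ← mul_assoc, mul_assoc (κ τ * expFactor M τ z), ← expPi_add]
  congr 3
  linear_combination -(1 / 4 : ℂ) * hchi

/-- The linear part of `n ↦ M ∘ n`. -/
def charLinear (M : Sp g) (n : Characteristic g) : Characteristic g := (M⁻¹).1ᵀ *ᵥ n

/-- Half of the translation part of `n ↦ M ∘ n`, whose entries are even for `M ∈ Γ_g(2)`. -/
def charShift (M : Sp g) : Characteristic g :=
  Sum.elim (fun i => (blkC M * (blkD M)ᵀ).diag i / 2) fun i => (blkA M * (blkB M)ᵀ).diag i / 2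

theorem transpose_mulVec_charLinear (M : Sp g) (n : Characteristic g) :
    M.1ᵀ *ᵥ charLinear M n = n := by
  have h : (M⁻¹).1 * M.1 = 1 := congrArg Subtype.val (inv_mul_cancel M)
  rw [charLinear, mulVec_mulVec, ← transpose_mul, h, transpose_one, one_mulVec]

theorem charLinear_eq (M : Sp g) (n : Characteristic g) :
    charLinear M n = Sum.elim (blkD M *ᵥ (n ∘ Sum.inl) - blkC M *ᵥ (n ∘ Sum.inr))
      (-(blkB M *ᵥ (n ∘ Sum.inl)) + blkA M *ᵥ (n ∘ Sum.inr)) := by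
  rw [charLinear, coe_inv_eq_fromBlocks, fromBlocks_transpose, fromBlocks_mulVec]
  simp only [transpose_neg, transpose_transpose, neg_mulVec, sub_eq_add_neg]

theorem two_dvd_diag_blkC_mul_blkD (hM : M ∈ Gamma2 g) (i : Fin g) :
    2 ∣ (blkC M * (blkD M)ᵀ).diag i := by
  rw [diag_apply, mul_apply]
  exact Finset.dvd_sum fun k _ =>
    ((even_apply_of_ne hM (x := Sum.inr i) (y := Sum.inl k) Sum.inr_ne_inl).two_dvd).mul_right _

theorem two_dvd_diag_blkA_mul_blkB (hM : M ∈ Gamma2 g) (i : Fin g) :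
    2 ∣ (blkA M * (blkB M)ᵀ).diag i := by
  rw [diag_apply, mul_apply]
  exact Finset.dvd_sum fun k _ =>
    ((even_apply_of_ne hM (x := Sum.inl i) (y := Sum.inr k) Sum.inl_ne_inr).two_dvd).mul_left _

theorem charAct_eq (hM : M ∈ Gamma2 g) (n : Characteristic g) :
    charAct M n = charLinear M n + (2 : ℤ) • charShift M := by
  rw [charLinear_eq]
  ext (i | i)
  · simp only [charAct, charShift, Sum.elim_inl, Pi.add_apply, Pi.smul_apply, smul_eq_mul,
      Int.mul_ediv_cancel' (two_dvd_diag_blkC_mul_blkD hM i)]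
  · simp only [charAct, charShift, Sum.elim_inr, Pi.add_apply, Pi.smul_apply, smul_eq_mul,
      Int.mul_ediv_cancel' (two_dvd_diag_blkA_mul_blkB hM i)]

theorem quad_charLinear (M : Sp g) (n : Characteristic g) :
    quad (charLinear M n) = quad n - (n ∘ Sum.inl) ⬝ᵥ ((blkB M)ᵀ * blkD M) *ᵥ (n ∘ Sum.inl)
      - (n ∘ Sum.inr) ⬝ᵥ ((blkA M)ᵀ * blkC M) *ᵥ (n ∘ Sum.inr)
      + 2 * ((n ∘ Sum.inl) ⬝ᵥ ((blkB M)ᵀ * blkC M) *ᵥ (n ∘ Sum.inr)) := by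
  have hmul (X Y : Matrix (Fin g) (Fin g) ℤ) (u v : Fin g → ℤ) :
      (X *ᵥ u) ⬝ᵥ (Y *ᵥ v) = u ⬝ᵥ (Xᵀ * Y) *ᵥ v := by
    rw [← mulVec_mulVec, dotProduct_mulVec u, vecMul_transpose]
  obtain ⟨hDA, hDB, hAC, -⟩ := blk_relations M
  have h := congrArg (fun X => (n ∘ Sum.inl) ⬝ᵥ X *ᵥ (n ∘ Sum.inr)) hDA
  simp only [sub_mulVec, one_mulVec, dotProduct_sub] at h
  rw [charLinear_eq, quad, Sum.elim_comp_inl, Sum.elim_comp_inr]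
  simp only [sub_dotProduct, dotProduct_add, dotProduct_neg]
  rw [dotProduct_comm (blkC M *ᵥ _) (blkB M *ᵥ _), hmul, hmul, hmul, hmul, hDB, ← hAC, quad]
  linear_combination h

theorem Phi_eq (M : Sp g) (n : Characteristic g) :
    Phi n M = 1 / 8 * (quad (charLinear M n) - quad n)
      + 1 / 4 * ((charLinear M n ∘ Sum.inl) ⬝ᵥ (blkA M * (blkB M)ᵀ).diag : ℤ) := by
  have hfst : charLinear M n ∘ Sum.inl
      = blkD M *ᵥ (n ∘ Sum.inl) - blkC M *ᵥ (n ∘ Sum.inr) := by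
    rw [charLinear_eq, Sum.elim_comp_inl]
  rw [Phi, quad_charLinear, ← hfst, dotProduct_comm _ (charLinear M n ∘ Sum.inl)]
  push_cast
  ring

theorem IsThetaFactor.thetaConst_charAct (hκ : IsThetaFactor M κ) (hM : M ∈ Gamma2 g)
    (n : Characteristic g) (hτ : τ ∈ SiegelUpperHalf g) :
    thetaConst (charAct M n) (act M τ) = κ τ * e (Phi n M) * thetaConst n τ := by
  have hshift : (blkA M * (blkB M)ᵀ).diag = (2 : ℤ) • (charShift M ∘ Sum.inr) :=
    funext fun i => (Int.mul_ediv_cancel' (two_dvd_diag_blkA_mul_blkB hM i)).symm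
  have hlin := hκ.theta (charLinear M n) hτ 0
  rw [mulVec_zero, expFactor_zero, mul_one, transpose_mulVec_charLinear] at hlin
  rw [thetaConst, thetaConst, charAct_eq hM, theta_add_two_smul, hlin, ← mul_assoc, mul_left_comm,
    ← expPi_add, e_eq_expPi, Phi_eq, hshift, dotProduct_smul, smul_eq_mul]
  congr 3
  push_cast
  ring

theorem IsThetaFactor.exists_multiplier (hκ : IsThetaFactor M κ) (hM : M ∈ Gamma2 g) :
    ∃ a s, IsThetaMultiplier M a s ∧ ∀ τ, a * s τ = κ τ := by
  obtain ⟨ζ, hζ, hsq⟩ := hκ.sq_eq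
  have hζ0 : ζ ≠ 0 := by rintro rfl; simp at hζ
  obtain ⟨a, ha⟩ := IsAlgClosed.exists_pow_nat_eq ζ two_pos
  have ha0 : a ≠ 0 := by rintro rfl; exact hζ0 (by simpa using ha.symm)
  have hκa (τ) : a * (κ τ / a) = κ τ := mul_div_cancel₀ _ ha0
  refine ⟨a, fun τ => κ τ / a, ⟨?_, hκ.continuousOn.div_const a, fun τ hτ => ?_,
    fun n τ hτ => ?_⟩, hκa⟩
  · rw [show 8 = 2 * 4 from rfl, pow_mul, ha, hζ]
  · rw [div_pow, hsq τ hτ, ha, mul_div_cancel_left₀ _ hζ0]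
  · rw [hκ.thetaConst_charAct hM n hτ]
    linear_combination -(e (Phi n M) * thetaConst n τ) * hκa τ

theorem IsThetaMultiplier.mul_eq {a : ℂ} {s : Matrix (Fin g) (Fin g) ℂ → ℂ}
    (h : IsThetaMultiplier M a s) (hκ : IsThetaFactor M κ) (hM : M ∈ Gamma2 g)
    (hτ : τ ∈ SiegelUpperHalf g) {n : Characteristic g} (hn : thetaConst n τ ≠ 0) :
    a * s τ = κ τ := by
  have he : e (Phi n M) ≠ 0 := Complex.exp_ne_zero _
  have htransform := h.transform n τ hτ
  rw [hκ.thetaConst_charAct hM n hτ] at htransform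
  refine mul_right_cancel₀ (mul_ne_zero he hn) ?_
  linear_combination -htransform

end Multiplier

section Nonvanishing

theorem expPi_eq_ofReal_norm {x : ℂ} {k : ℤ} (hx : x.re = 2 * k) : expPi x = ‖expPi x‖ := by
  have hre : (x.re : ℂ) = 2 * k := by exact_mod_cast hx
  have himag : expPi x = expPi (x.im * Complex.I) := by
    rw [← expPi_add_two_mul_int (x.im * Complex.I) k, ← hre, add_comm, Complex.re_add_im]
  rw [norm_expPi, himag, expPi, Complex.ofReal_exp]
  congr 1
  push_cast
  linear_combination (Real.pi * x.im : ℂ) * Complex.I_sq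

/-- The point `i1 + m'' ᵗm''` of the Siegel upper half-space, at which all terms of the series
`θ_m(τ)` are positive if `m` is even. -/
def realPoint (m : Characteristic g) : Matrix (Fin g) (Fin g) ℂ :=
  Complex.I • 1 + vecMulVec (sndV m) (sndV m)

theorem realPoint_mem (m : Characteristic g) : realPoint m ∈ SiegelUpperHalf g := by
  have him : (realPoint m).map Complex.im = 1 := by
    ext i j
    by_cases h : i = j <;> simp [realPoint, h, one_apply, vecMulVec_apply, sndV, castV]
  exact ⟨by simp [realPoint, transpose_vecMulVec], him ▸ PosDef.one⟩

theorem thetaTerm_realPoint {m : Characteristic g} (hm : IsEvenChar m) (p : Fin g → ℤ) :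
    thetaTerm (realPoint m) ((1 / 2 : ℂ) • sndV m) (castV p + (1 / 2 : ℂ) • fstV m)
      = ‖thetaTerm (realPoint m) ((1 / 2 : ℂ) • sndV m) (castV p + (1 / 2 : ℂ) • fstV m)‖ := by
  set v := castV p + (1 / 2 : ℂ) • fstV m with hv
  obtain ⟨t, ht⟩ : ∃ t : ℤ, v ⬝ᵥ sndV m = t := by
    obtain ⟨r, hr⟩ := hm
    refine ⟨p ⬝ᵥ (m ∘ Sum.inr) + r, ?_⟩
    rw [hv, add_dotProduct, smul_dotProduct, fstV, sndV, dotProduct_castV, dotProduct_castV, hr]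
    push_cast
    rw [smul_eq_mul]
    ring
  obtain ⟨w, hw⟩ : ∃ w : ℝ, v ⬝ᵥ v = w := by
    refine ⟨∑ i, ((p i : ℝ) + m (Sum.inl i) / 2) ^ 2, ?_⟩
    push_cast
    refine Finset.sum_congr rfl fun i _ => ?_
    simp [hv, castV, fstV]
    ring
  obtain ⟨k, hk⟩ : ∃ k, t * (t + 1) = 2 * k := (Int.even_mul_succ_self t).two_dvd
  have hexp : v ⬝ᵥ realPoint m *ᵥ v + 2 * (v ⬝ᵥ (1 / 2 : ℂ) • sndV m)
      = Complex.I * w + (t * (t + 1) : ℤ) := by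
    rw [realPoint, add_mulVec, smul_mulVec, one_mulVec, vecMulVec_mulVec, dotProduct_add,
      dotProduct_smul, dotProduct_smul, dotProduct_smul, hw, dotProduct_comm (sndV m), ht]
    simp
    ring
  exact expPi_eq_ofReal_norm (k := k) (by rw [hexp, hk]; simp)

theorem exists_thetaConst_ne_zero {m : Characteristic g} (hm : IsEvenChar m) :
    ∃ τ ∈ SiegelUpperHalf g, thetaConst m τ ≠ 0 := by
  have hτ := realPoint_mem m
  let f (p : Fin g → ℤ) : ℂ :=
    thetaTerm (realPoint m) ((1 / 2 : ℂ) • sndV m) (castV p + (1 / 2 : ℂ) • fstV m)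
  have hf : Summable f := by
    simp only [f, thetaTerm_add hτ.1]
    exact (summable_thetaTerm hτ _).mul_left _
  have hsum : thetaConst m (realPoint m) = (∑' p, ‖f p‖ : ℝ) := by
    rw [thetaConst, theta_eq_tsum, zero_add, Complex.ofReal_tsum]
    exact tsum_congr fun p => thetaTerm_realPoint hm p
  refine ⟨realPoint m, hτ, ?_⟩
  rw [hsum, Complex.ofReal_ne_zero]
  exact (hf.norm.tsum_pos (fun p => norm_nonneg _) 0 (norm_pos_iff.2 (expPi_ne_zero _))).ne'

theorem exists_theta_ne_zero (m : Characteristic g) :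
    ∃ τ ∈ SiegelUpperHalf g, thetaConst 0 τ ≠ 0 ∧ ∃ z, theta m τ z ≠ 0 := by
  have hzero : IsEvenChar (0 : Characteristic g) := ⟨0, by simp [dotProduct]⟩
  obtain ⟨τ, hτ, hne⟩ := exists_thetaConst_ne_zero hzero
  refine ⟨τ, hτ, hne, -((1 / 2 : ℂ) • periodVec τ m), ?_⟩
  have hperiod : periodVec τ (0 : Characteristic g) = 0 := by
    ext i; simp [periodVec, fstV, sndV, castV, mulVec, dotProduct]
  rw [thetaConst, theta_eq_thetaZero 0 hτ.1, hperiod, smul_zero, add_zero] at hne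
  rw [theta_eq_thetaZero m hτ.1, neg_add_cancel]
  exact mul_ne_zero (expPi_ne_zero _) (right_ne_zero_of_mul hne)

end Nonvanishing

section CharacterValues

variable {M : Sp g} {m : Characteristic g} {χ : ℂ}

theorem IsThetaMultiplier.eq_expPi_chiExp {a : ℂ} {s : Matrix (Fin g) (Fin g) ℂ → ℂ}
    (h : IsThetaMultiplier M a s) (hM : M ∈ Gamma2 g) {τ : Matrix (Fin g) (Fin g) ℂ}
    (hτ : τ ∈ SiegelUpperHalf g) {n : Characteristic g} (hn : thetaConst n τ ≠ 0) {z : Fin g → ℂ}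
    (hz : theta m τ z ≠ 0) (hχ : theta m (act M τ) (((autFactor M τ)⁻¹)ᵀ *ᵥ z) =
      a * χ * s τ * expFactor M τ z * theta m τ z) :
    χ = expPi (1 / 2 * chiExp m M) := by
  obtain ⟨κ, hκ⟩ := Gamma2_le_thetaGroup hM
  have hexp : expFactor M τ z ≠ 0 := Complex.exp_ne_zero _
  rw [hκ.theta_of_mem_Gamma2 hM m hτ z, mul_right_comm a, h.mul_eq hκ hM hτ hn,
    mul_right_comm (κ τ) χ] at hχ
  exact (mul_left_cancel₀ (mul_ne_zero (hκ.ne_zero hτ) hexp) (mul_right_cancel₀ hz hχ)).symm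

theorem IsCharValue.isConstCharValue (h : IsCharValue m M χ) : IsConstCharValue m M χ := by
  obtain ⟨a, s, has, htheta⟩ := h
  refine ⟨a, s, has, fun τ hτ => ?_⟩
  have h := htheta τ hτ 0
  change _ = _ * expFactor M τ 0 * _ at h
  rwa [mulVec_zero, expFactor_zero, mul_one] at h

theorem isCharValue_iff (hM : M ∈ Gamma2 g) :
    IsCharValue m M χ ↔ χ = expPi (1 / 2 * chiExp m M) := by
  constructor
  · rintro ⟨a, s, has, htheta⟩
    obtain ⟨τ, hτ, hzero, z, hz⟩ := exists_theta_ne_zero m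
    exact has.eq_expPi_chiExp hM hτ hzero hz (htheta τ hτ z)
  · rintro rfl
    obtain ⟨κ, hκ⟩ := Gamma2_le_thetaGroup hM
    obtain ⟨a, s, has, hκs⟩ := hκ.exists_multiplier hM
    refine ⟨a, s, has, fun τ hτ z => ?_⟩
    rw [hκ.theta_of_mem_Gamma2 hM m hτ z, ← hκs τ, expFactor, autQuot]
    ring

theorem isConstCharValue_iff (hM : M ∈ Gamma2 g) (hm : IsEvenChar m) :
    IsConstCharValue m M χ ↔ χ = expPi (1 / 2 * chiExp m M) := by
  refine ⟨?_, fun h => ((isCharValue_iff hM).2 h).isConstCharValue⟩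
  rintro ⟨a, s, has, htheta⟩
  obtain ⟨τ, hτ, hne⟩ := exists_thetaConst_ne_zero hm
  refine has.eq_expPi_chiExp hM hτ hne hne ?_
  rw [mulVec_zero, expFactor_zero, mul_one]
  exact htheta τ hτ

theorem expPi_half_eq {c x y : ℤ} (h : (c : ZMod 4) = 2 * x - y) :
    expPi (1 / 2 * c) = (-1) ^ x * e (-y / 4) := by
  obtain ⟨k, hk⟩ := (ZMod.intCast_eq_intCast_iff_dvd_sub c (2 * x - y) 4).1 (by push_cast; exact h)
  have hc : (1 / 2 * c : ℂ) = x + -y / 2 + 2 * (-k : ℤ) := by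
    have : (2 * x - y - c : ℂ) = 4 * k := by exact_mod_cast hk
    push_cast
    linear_combination -(1 / 2 : ℂ) * this
  have hx : expPi x = (-1) ^ x := by
    rw [expPi, mul_comm, Complex.exp_int_mul, Complex.exp_pi_mul_I]
  rw [hc, expPi_add_two_mul_int, expPi_add, hx, e_eq_expPi]
  congr 2
  ring

end CharacterValues

end SiegelTheta

end

/-- The lists `lA`, `lB`, `lC` fix arbitrary orders in which the three products are taken. -/
theorem theorem3p4 (g : ℕ) (lA lB lC : List (Fin g × Fin g))
    (hA : SiegelTheta.Enumerates lA fun _ _ => True)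
    (hB : SiegelTheta.Enumerates lB fun i j => i ≤ j)
    (hC : SiegelTheta.Enumerates lC fun i j => i ≤ j) :
    -- the commutator subgroup of `Γ_g(2)` lies in `Γ_g(4,8)`
    (∀ M' ∈ ⁅SiegelTheta.Gamma2 g, SiegelTheta.Gamma2 g⁆, M' ∈ SiegelTheta.Gamma48 g) ∧
    -- every `M ∈ Γ_g(2)` can be written in the required form
    (∀ M ∈ SiegelTheta.Gamma2 g, ∃ p q r : Fin g → Fin g → ℤ,
      ∃ M' ∈ ⁅SiegelTheta.Gamma2 g, SiegelTheta.Gamma2 g⁆,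
        M = SiegelTheta.orderedProd lA SiegelTheta.A p * SiegelTheta.orderedProd lB SiegelTheta.B q
          * SiegelTheta.orderedProd lC SiegelTheta.C r * M') ∧
    -- for every way of writing `M` in this form, `χ_m(M) = (-1)^A e(-B/4)`
    (∀ M ∈ SiegelTheta.Gamma2 g, ∀ p q r : Fin g → Fin g → ℤ,
      ∀ M' ∈ ⁅SiegelTheta.Gamma2 g, SiegelTheta.Gamma2 g⁆,
        M = SiegelTheta.orderedProd lA SiegelTheta.A p * SiegelTheta.orderedProd lB SiegelTheta.B q
          * SiegelTheta.orderedProd lC SiegelTheta.C r * M' →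
        ∀ m : SiegelTheta.Characteristic g,
          (∀ χ : ℂ, SiegelTheta.IsCharValue m M χ ↔
            χ = (-1 : ℂ) ^ SiegelTheta.expA p q r m
              * SiegelTheta.e (-(SiegelTheta.expB q r m : ℂ) / 4)) ∧
          (SiegelTheta.IsEvenChar m → ∀ χ : ℂ, SiegelTheta.IsConstCharValue m M χ ↔
            χ = (-1 : ℂ) ^ SiegelTheta.expA p q r m
              * SiegelTheta.e (-(SiegelTheta.expB q r m : ℂ) / 4))) := by
  refine ⟨fun _ => SiegelTheta.commutator_subset_Gamma48,
    fun _ => SiegelTheta.exists_decomposition hA hB hC, ?_⟩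
  intro M hM p q r M' hM' hdec m
  have hchi := SiegelTheta.chiExp_decomposition hA hB hC p q r hM' m
  rw [← hdec] at hchi
  rw [← SiegelTheta.expPi_half_eq hchi]
  exact ⟨fun _ => SiegelTheta.isCharValue_iff hM,
    fun hm _ => SiegelTheta.isConstCharValue_iff hM hm⟩
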